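/- Let $k$ be a field of characteristic zero, let $G,M$ be finite groups, and let $X=G\ltimes M$ be a semidirect product in which $M$ is normal; write $s\triangleleft u=u^{-1}su$ for the right action of $u\in G$ on $s\in M$. Let $A=k(M)\rtimes kG$ be the Hopf algebra with basis $\delta_s\otimes u$ ($s\in M,\ u\in G$) and $$(\delta_s\otimes u)(\delta_t\otimes v)=\delta_{s\triangleleft u,t}\,\delta_s\otimes uv,\qquad \Delta(\delta_s\otimes u)=\sum_{ab=s}(\delta_a\otimes u)\otimes(\delta_b\otimes u),\qquad \varepsilon(\delta_s\otimes u)=\delta_{s,e},$$ and let $H$ be its dual Hopf algebra, with the dual basis $t\otimes\delta_v$ ($t\in M,\ v\in G$). A quantum tangent space is a subspace $L$ of $H^+=\ker\varepsilon\subset H$ stable under the right adjoint action $g\triangleleft h=\sum S(h_1)gh_2$ of $H$ and under the actions $h\triangleleft a=\sum h_1\langle h_2,a\rangle-\langle a,h\rangle 1$ of $a\in A=H^*$, that is, under the quantum double $D(H)$. It is called irreducible if it is non-zero and contains no other non-zero quantum tangent space. It defines the calculus $\Omega^1=A\otimes\Lambda^1$, $\Lambda^1=L^*$, with $$a\cdot(b\otimes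 x)=ab\otimes x,\quad (b\otimes x)\cdot a=\sum ba_1\otimes(x\triangleleft a_2),\quad \langle x\triangleleft a,l\rangle=\langle x,l\triangleleft a\rangle,\quad da=\sum a_1\otimes\pi(a_2-\varepsilon(a_2)1),$$ where $\pi:A^+=\ker\varepsilon\to\Lambda^1$ is adjoint to the inclusion $L\subset H^+$. Let $\Pi:kX\to H^+$ be the linear map $vt\mapsto t\otimes\delta_v-\varepsilon(t\otimes\delta_v)1$ ($v\in G$, $t\in M$). Make $kX$ an $X$-graded right $X$-module (a $D(X)$-module) by the degree $\|vt\|=v^{-1}t^{-1}v$ and the action $vt\,\tilde\triangleleft\,us=vu\,(\tilde st\tilde s^{-1})$, $\tilde s=s^{-1}\triangleleft(vu)^{-1}$ ($u,v\in G$, $s,t\in M$). Let $C\neq\{e\}$ be a conjugacy class of $M$ that is invariant under the action of $G$. For $a\in C$ put $f_a=\sum_{v\in G}v\,(a^{-1}\triangleleft v^{-1})\in kX$, and let $\mathcal M=\sum_{a\in C}k f_a$. Then: (i) The $f_a$ are linearly independent, so $\mathcal M=\bigoplus_{a\in C}kf_a$. The set $C$ is a conjugacy class of $X$ contained in the set $Z$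 of degrees of elements of $X$. For every $z_0\in C$, the line $\mathcal M_0=kf_{z_0}$ is an irreducible subrepresentation, under the centralizer of $z_0$ in $X$, of the span $J_{z_0}$ of the elements of $X$ of degree $z_0$, and $\mathcal M=\bigoplus_{z\in C}\mathcal M_0\,\tilde\triangleleft\,\bar z$ for every choice of $\bar z\in X$ with $z=\bar z^{-1}z_0\bar z$. The subspace $\mathcal M$ is an irreducible $D(X)$-submodule of $kX$. If $kX$ is identified with $H$ by $vt\equiv t\otimes\delta_v$, then $\mathcal M$ is also stable under the right adjoint action of $H$ and the coregular action $h\mapsto\sum h_1\langle h_2,a\rangle$ of $a\in A$, and $\Pi$ restricts to an isomorphism, equivariant for the actions of $D(H)$, of $\mathcal M$ onto an irreducible quantum tangent space $L=\Pi(\mathcal M)\subset H^+$. (ii) The calculus on $A$ defined by $L$ (the canonical calculus) is a bicovariant differential calculus. If $(e_a)_{a\in C}$ is the basis of $\Lambda^1=L^*$ dual to $(\Pi(f_a))_{a\in C}$, then for $s\in M$ and $u\in G$ $$e_a\delta_s=\delta_{sa}e_a,\quad e_au=u\,e_{u^{-1}au},\quad d\delta_s=\sum_{a\in C}(\delta_{sa}-\delta_s)e_a,\quad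 du=\sum_{a\in C}u\,(e_{u^{-1}au}-e_a).$$ The restriction of this calculus to $k(M)\subset A$, that is, the span of the forms $f\,dg$ with $f,g\in k(M)$, together with $d|_{k(M)}$, is isomorphic, with $e_a$ corresponding to $e_{a^{-1}}$, to the calculus on $k(M)$ defined by the conjugacy class $C^{-1}$. The latter is the free left $k(M)$-module on $\{e_b:b\in C^{-1}\}$ with $e_bf=R_b(f)e_b$, $df=\sum_{b\in C^{-1}}(R_b(f)-f)e_b$ and $R_b(f)(x)=f(xb)$. (iii) Let $D(G)=k(G)\rtimes kG$ be the quantum double of $G$, that is, the case $M=G$ with $G$ acting by conjugation. Every conjugacy class $K\neq\{e\}$ of $G$ is $G$-invariant, so that the construction above gives an irreducible quantum tangent space and a bicovariant differential calculus on $D(G)$. -/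

import Mathlib

open TensorProduct SemidirectProduct
open scoped Classical

noncomputable section


section HopfAlgebras

variable (k : Type*) [Field k] {G M : Type*} [Group G] [Group M]

/-- The right action `s ◁ u` of `G` on `M` in the semidirect product `X = M ⋊[φ] G`; inside `X` it is
`u⁻¹ s u`, so that `s u = u (s ◁ u)`. -/
def ract (φ : G →* MulAut M) (s : M) (u : G) : M := φ u⁻¹ s

theorem inl_ract (φ : G →* MulAut M) (s : M) (u : G) :
    (inl (ract φ s u) : M ⋊[φ] G) = inr u⁻¹ * inl s * inr u := by
  rw [ract, SemidirectProduct.inl_aut, inv_inv]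

@[simp] theorem ract_one (φ : G →* MulAut M) (s : M) : ract φ s 1 = s := by simp [ract]

@[simp] theorem one_ract (φ : G →* MulAut M) (u : G) : ract φ 1 u = 1 := by simp [ract]

@[simp] theorem ract_ract (φ : G →* MulAut M) (s : M) (u v : G) :
    ract φ (ract φ s u) v = ract φ s (u * v) := by simp [ract]

theorem mul_ract (φ : G →* MulAut M) (s t : M) (u : G) :
    ract φ (s * t) u = ract φ s u * ract φ t u := by simp [ract]

theorem inv_ract (φ : G →* MulAut M) (s : M) (u : G) :
    ract φ s⁻¹ u = (ract φ s u)⁻¹ := by simp [ract]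

@[simp] theorem ract_eq_one (φ : G →* MulAut M) (s : M) (u : G) : ract φ s u = 1 ↔ s = 1 := by
  simp [ract]

theorem ract_inj (φ : G →* MulAut M) {s t : M} {u : G} : ract φ s u = ract φ t u ↔ s = t := by
  simp [ract]

/-- The Hopf algebra `A = k(M) ⋊ kG`, with basis `δ_s ⊗ u`, `s ∈ M`, `u ∈ G`. -/
def CrossProduct (_φ : G →* MulAut M) : Type _ := M × G →₀ k

/-- The dual Hopf algebra `H` of `k(M) ⋊ kG`: the algebra `kM ⊗ k(G)` with a cross coproduct
coalgebra structure. It has basis `t ⊗ δ_v`, `t ∈ M`, `v ∈ G`. -/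
def CrossCoproduct (_φ : G →* MulAut M) : Type _ := M × G →₀ k

namespace CrossProduct

variable (φ : G →* MulAut M)

instance : AddCommGroup (CrossProduct k φ) := inferInstanceAs (AddCommGroup (M × G →₀ k))

instance : Module k (CrossProduct k φ) := inferInstanceAs (Module k (M × G →₀ k))

/-- The basis `δ_s ⊗ u` of `k(M) ⋊ kG`, indexed by the pairs `(s, u)`. -/
def basis : Module.Basis (M × G) k (CrossProduct k φ) :=
  (Finsupp.basisSingleOne : Module.Basis (M × G) k (M × G →₀ k))

/-- The product, `(δ_s ⊗ u)(δ_t ⊗ v) = δ_{s ◁ u, t} (δ_s ⊗ uv)`. -/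
def mulHom : CrossProduct k φ →ₗ[k] CrossProduct k φ →ₗ[k] CrossProduct k φ :=
  (basis k φ).constr k fun p => (basis k φ).constr k fun q =>
    if ract φ p.1 p.2 = q.1 then basis k φ (p.1, p.2 * q.2) else 0

theorem mulHom_basis (p q : M × G) : mulHom k φ (basis k φ p) (basis k φ q) =
    if ract φ p.1 p.2 = q.1 then basis k φ (p.1, p.2 * q.2) else 0 := by
  simp [mulHom, Module.Basis.constr_basis]

theorem mulHom_assoc (x y z : CrossProduct k φ) :
    mulHom k φ (mulHom k φ x y) z = mulHom k φ x (mulHom k φ y z) := by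
  have h : ∀ p q r, mulHom k φ (mulHom k φ (basis k φ p) (basis k φ q)) (basis k φ r) =
      mulHom k φ (basis k φ p) (mulHom k φ (basis k φ q) (basis k φ r)) := by
    rintro ⟨s, u⟩ ⟨t, v⟩ ⟨r, w⟩
    simp only [mulHom_basis]
    by_cases h1 : ract φ s u = t
    · subst h1
      by_cases h2 : ract φ s (u * v) = r <;> simp [h2, mulHom_basis, mul_assoc]
    · by_cases h2 : ract φ t v = r <;> simp [h1, h2, mulHom_basis]
  have h1 : ∀ p q, mulHom k φ (mulHom k φ (basis k φ p) (basis k φ q)) =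
      mulHom k φ (basis k φ p) ∘ₗ (mulHom k φ (basis k φ q)) := fun p q =>
    (basis k φ).ext (h p q)
  have h2 : ∀ p, (mulHom k φ).flip z ∘ₗ mulHom k φ (basis k φ p) =
      mulHom k φ (basis k φ p) ∘ₗ (mulHom k φ).flip z := fun p =>
    (basis k φ).ext fun q => LinearMap.congr_fun (h1 p q) z
  have h3 : (mulHom k φ).flip z ∘ₗ (mulHom k φ).flip y =
      (mulHom k φ).flip (mulHom k φ y z) :=
    (basis k φ).ext fun p => LinearMap.congr_fun (h2 p) y
  exact LinearMap.congr_fun h3 x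

variable [Fintype M]

/-- The unit, `1 = ∑_s δ_s ⊗ e`. -/
def unit : CrossProduct k φ := ∑ s : M, basis k φ (s, 1)

theorem mulHom_unit_left (x : CrossProduct k φ) : mulHom k φ (unit k φ) x = x := by
  have : mulHom k φ (unit k φ) = LinearMap.id :=
    (basis k φ).ext fun q => by
      simp [unit, mulHom_basis, LinearMap.sum_apply]
  simp [this]

theorem mulHom_unit_right (x : CrossProduct k φ) : mulHom k φ x (unit k φ) = x := by
  have : (mulHom k φ).flip (unit k φ) = LinearMap.id :=
    (basis k φ).ext fun q => by
      simp [unit, mulHom_basis, LinearMap.sum_apply]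
  exact LinearMap.congr_fun this x

instance : Ring (CrossProduct k φ) :=
  { (inferInstance : AddCommGroup (CrossProduct k φ)) with
    mul := fun x y => mulHom k φ x y
    one := unit k φ
    left_distrib := fun x y z => map_add (mulHom k φ x) y z
    right_distrib := fun x y z => LinearMap.map_add₂ (mulHom k φ) x y z
    zero_mul := fun x => LinearMap.map_zero₂ (mulHom k φ) x
    mul_zero := fun x => map_zero (mulHom k φ x)
    mul_assoc := mulHom_assoc k φ
    one_mul := mulHom_unit_left k φ
    mul_one := mulHom_unit_right k φ }

instance : Algebra k (CrossProduct k φ) :=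
  Algebra.ofModule (fun r x y => LinearMap.map_smul₂ (mulHom k φ) r x y)
    (fun r x y => map_smul (mulHom k φ x) r y)

theorem basis_mul_basis (p q : M × G) : basis k φ p * basis k φ q =
    if ract φ p.1 p.2 = q.1 then basis k φ (p.1, p.2 * q.2) else 0 := mulHom_basis k φ p q

theorem one_def : (1 : CrossProduct k φ) = ∑ s : M, basis k φ (s, 1) := rfl

/-- The coproduct `Δ(δ_s ⊗ u) = ∑_{ab = s} (δ_a ⊗ u) ⊗ (δ_b ⊗ u)`
and the counit `ε(δ_s ⊗ u) = δ_{s,e}`. -/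
instance : CoalgebraStruct k (CrossProduct k φ) where
  comul := (basis k φ).constr k fun p => 
    ∑ b : M, basis k φ (p.1 * b⁻¹, p.2) ⊗ₜ[k] basis k φ (b, p.2)
  counit := (basis k φ).constr k fun p => if p.1 = 1 then 1 else 0

theorem comul_basis (p : M × G) : CoalgebraStruct.comul (R := k) (basis k φ p) = 
    ∑ b : M, basis k φ (p.1 * b⁻¹, p.2) ⊗ₜ[k] basis k φ (b, p.2) :=
  Module.Basis.constr_basis ..

theorem counit_basis (p : M × G) : CoalgebraStruct.counit (R := k) (basis k φ p) =
    if p.1 = 1 then 1 else 0 :=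
  Module.Basis.constr_basis ..

instance : Coalgebra k (CrossProduct k φ) where
  coassoc := (basis k φ).ext fun p => by
    simp only [LinearMap.comp_apply, comul_basis, map_sum, LinearMap.rTensor_tmul,
      LinearMap.lTensor_tmul, TensorProduct.sum_tmul, TensorProduct.tmul_sum,
      LinearEquiv.coe_coe, TensorProduct.assoc_tmul]
    conv_rhs => rw [Finset.sum_comm]
    refine Finset.sum_congr rfl fun b _ => ?_
    refine Fintype.sum_equiv (Equiv.mulRight b) _ _ fun c => ?_
    simp [mul_assoc]
  rTensor_counit_comp_comul := (basis k φ).ext fun p => by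
    simp [comul_basis, counit_basis, mul_inv_eq_one, ite_tmul]
  lTensor_counit_comp_comul := (basis k φ).ext fun p => by
    simp [comul_basis, counit_basis, tmul_ite]

instance : Bialgebra k (CrossProduct k φ) where
  counit_one := by
    simp [one_def, counit_basis]
  mul_compr₂_counit := (basis k φ).ext fun p => (basis k φ).ext fun q => by
    obtain ⟨s, u⟩ := p
    obtain ⟨t, v⟩ := q
    simp only [LinearMap.compr₂_apply, LinearMap.mul_apply', LinearMap.compl₁₂_apply,
      basis_mul_basis, counit_basis]
    by_cases h : ract φ s u = t
    · subst h
      by_cases h1 : s = 1 <;> simp [h1, counit_basis]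
    · by_cases h1 : s = 1
      · subst h1
        have : t ≠ 1 := fun h2 => h (by simp [h2])
        simp [this, this.symm]
      · simp [h, h1]
  comul_one := by
    simp only [one_def, map_sum, comul_basis, Algebra.TensorProduct.one_def,
      TensorProduct.sum_tmul, TensorProduct.tmul_sum]
    rw [Finset.sum_comm]
    refine Finset.sum_congr rfl fun b _ => ?_
    exact Fintype.sum_equiv (Equiv.mulRight b⁻¹) _ _ fun c => rfl
  mul_compr₂_comul := (basis k φ).ext fun p => (basis k φ).ext fun q => by
    obtain ⟨s, u⟩ := p
    obtain ⟨t, v⟩ := q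
    simp only [LinearMap.compr₂_apply, LinearMap.mul_apply', LinearMap.compl₁₂_apply,
      comul_basis, Finset.sum_mul_sum, Algebra.TensorProduct.tmul_mul_tmul, basis_mul_basis]
    have h0 : ∀ b c : M, (ract φ (s * b⁻¹) u = t * c⁻¹ ∧ ract φ b u = c) ↔
        (ract φ s u = t ∧ ract φ b u = c) := fun b c =>
      and_congr_left fun hc => by
        subst hc
        rw [mul_ract, inv_ract, mul_left_inj]
    have h1 : ∀ b c : M, ((if ract φ (s * b⁻¹) u = t * c⁻¹ then basis k φ (s * b⁻¹, u * v) else 0)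
        ⊗ₜ[k] (if ract φ b u = c then basis k φ (b, u * v) else 0)) =
        if ract φ b u = c then (if ract φ s u = t then
          basis k φ (s * b⁻¹, u * v) ⊗ₜ[k] basis k φ (b, u * v) else 0) else 0 := fun b c => by
      have := h0 b c
      by_cases hc : ract φ b u = c
      · simp only [hc, and_true] at this
        simp only [this, hc, if_true, ite_tmul]
      · simp [hc]
    simp only [h1, Finset.sum_ite_eq, Finset.mem_univ, if_true]
    split_ifs with h
    · exact comul_basis k φ (s, u * v)
    · simp

/-- The antipode `S(δ_s ⊗ u) = δ_{(s ◁ u)⁻¹} ⊗ u⁻¹`. -/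
instance : HopfAlgebra k (CrossProduct k φ) where
  antipode := (basis k φ).constr k fun p => basis k φ ((ract φ p.1 p.2)⁻¹, p.2⁻¹)
  mul_antipode_rTensor_comul := (basis k φ).ext fun p => by
    obtain ⟨s, u⟩ := p
    simp only [LinearMap.comp_apply, comul_basis, map_sum, LinearMap.rTensor_tmul,
      Module.Basis.constr_basis, LinearMap.mul'_apply, basis_mul_basis, counit_basis]
    have h0 : ∀ b : M, ract φ (ract φ (s * b⁻¹) u)⁻¹ u⁻¹ = b ↔ s = 1 := fun b => by
      rw [inv_ract, ract_ract, mul_inv_cancel, ract_one]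
      simp
    simp only [h0, Algebra.linearMap_apply]
    by_cases hs : s = 1
    · subst hs
      simp only [if_true, one_mul, inv_mul_cancel, map_one, one_def, inv_ract, inv_inv]
      exact Fintype.sum_equiv (Equiv.ofBijective (fun b => ract φ b u)
        (Finite.injective_iff_bijective.1 fun _ _ h => (ract_inj φ).1 h)) _ _ fun c => rfl
    · simp [hs]
  mul_antipode_lTensor_comul := (basis k φ).ext fun p => by
    obtain ⟨s, u⟩ := p
    simp only [LinearMap.comp_apply, comul_basis, map_sum, LinearMap.lTensor_tmul,
      Module.Basis.constr_basis, LinearMap.mul'_apply, basis_mul_basis, counit_basis]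
    have h0 : ∀ b : M, ract φ (s * b⁻¹) u = (ract φ b u)⁻¹ ↔ s = 1 := fun b => by
      rw [← inv_ract, ract_inj]
      simp
    simp only [h0, Algebra.linearMap_apply]
    by_cases hs : s = 1
    · subst hs
      simp only [if_true, one_mul, mul_inv_cancel, map_one, one_def]
      exact Fintype.sum_equiv (Equiv.inv M) _ _ fun c => rfl
    · simp [hs]

end CrossProduct

namespace CrossCoproduct

variable (φ : G →* MulAut M)

instance : AddCommGroup (CrossCoproduct k φ) := inferInstanceAs (AddCommGroup (M × G →₀ k))

instance : Module k (CrossCoproduct k φ) := inferInstanceAs (Module k (M × G →₀ k))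

/-- The basis `t ⊗ δ_v` of `H`, indexed by the pairs `(t, v)`. -/
def basis : Module.Basis (M × G) k (CrossCoproduct k φ) :=
  (Finsupp.basisSingleOne : Module.Basis (M × G) k (M × G →₀ k))

/-- The product, `(s ⊗ δ_u)(t ⊗ δ_v) = δ_{u, v} (st ⊗ δ_v)`. -/
def mulHom : CrossCoproduct k φ →ₗ[k] CrossCoproduct k φ →ₗ[k] CrossCoproduct k φ :=
  (basis k φ).constr k fun p => (basis k φ).constr k fun q =>
    if p.2 = q.2 then basis k φ (p.1 * q.1, q.2) else 0

theorem mulHom_basis (p q : M × G) : mulHom k φ (basis k φ p) (basis k φ q) =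
    if p.2 = q.2 then basis k φ (p.1 * q.1, q.2) else 0 := by
  simp [mulHom, Module.Basis.constr_basis]

theorem mulHom_assoc (x y z : CrossCoproduct k φ) :
    mulHom k φ (mulHom k φ x y) z = mulHom k φ x (mulHom k φ y z) := by
  have h : ∀ p q r, mulHom k φ (mulHom k φ (basis k φ p) (basis k φ q)) (basis k φ r) =
      mulHom k φ (basis k φ p) (mulHom k φ (basis k φ q) (basis k φ r)) := by
    rintro ⟨s, u⟩ ⟨t, v⟩ ⟨r, w⟩
    simp only [mulHom_basis]
    by_cases h1 : u = v
    · subst h1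
      by_cases h2 : u = w <;> simp [h2, mulHom_basis, mul_assoc]
    · by_cases h2 : v = w
      · subst h2
        simp [h1, mulHom_basis]
      · simp [h1, h2, mulHom_basis]
  have h1 : ∀ p q, mulHom k φ (mulHom k φ (basis k φ p) (basis k φ q)) =
      mulHom k φ (basis k φ p) ∘ₗ (mulHom k φ (basis k φ q)) := fun p q =>
    (basis k φ).ext (h p q)
  have h2 : ∀ p, (mulHom k φ).flip z ∘ₗ mulHom k φ (basis k φ p) =
      mulHom k φ (basis k φ p) ∘ₗ (mulHom k φ).flip z := fun p =>
    (basis k φ).ext fun q => LinearMap.congr_fun (h1 p q) z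
  have h3 : (mulHom k φ).flip z ∘ₗ (mulHom k φ).flip y =
      (mulHom k φ).flip (mulHom k φ y z) :=
    (basis k φ).ext fun p => LinearMap.congr_fun (h2 p) y
  exact LinearMap.congr_fun h3 x

variable [Fintype G]

/-- The unit, `1 = ∑_u e ⊗ δ_u`. -/
def unit : CrossCoproduct k φ := ∑ u : G, basis k φ (1, u)

theorem mulHom_unit_left (x : CrossCoproduct k φ) : mulHom k φ (unit k φ) x = x := by
  have : mulHom k φ (unit k φ) = LinearMap.id :=
    (basis k φ).ext fun q => by
      simp [unit, mulHom_basis, LinearMap.sum_apply]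
  simp [this]

theorem mulHom_unit_right (x : CrossCoproduct k φ) : mulHom k φ x (unit k φ) = x := by
  have : (mulHom k φ).flip (unit k φ) = LinearMap.id :=
    (basis k φ).ext fun q => by
      simp [unit, mulHom_basis, LinearMap.sum_apply]
  exact LinearMap.congr_fun this x

instance : Ring (CrossCoproduct k φ) :=
  { (inferInstance : AddCommGroup (CrossCoproduct k φ)) with
    mul := fun x y => mulHom k φ x y
    one := unit k φ
    left_distrib := fun x y z => map_add (mulHom k φ x) y z
    right_distrib := fun x y z => LinearMap.map_add₂ (mulHom k φ) x y z
    zero_mul := fun x => LinearMap.map_zero₂ (mulHom k φ) x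
    mul_zero := fun x => map_zero (mulHom k φ x)
    mul_assoc := mulHom_assoc k φ
    one_mul := mulHom_unit_left k φ
    mul_one := mulHom_unit_right k φ }

instance : Algebra k (CrossCoproduct k φ) :=
  Algebra.ofModule (fun r x y => LinearMap.map_smul₂ (mulHom k φ) r x y)
    (fun r x y => map_smul (mulHom k φ x) r y)

theorem basis_mul_basis (p q : M × G) : basis k φ p * basis k φ q =
    if p.2 = q.2 then basis k φ (p.1 * q.1, q.2) else 0 := mulHom_basis k φ p q

theorem one_def : (1 : CrossCoproduct k φ) = ∑ u : G, basis k φ (1, u) := rfl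

/-- The coproduct `Δ(s ⊗ δ_u) = ∑_{xy = u} (s ⊗ δ_x) ⊗ ((s ◁ x) ⊗ δ_y)`
and the counit `ε(s ⊗ δ_u) = δ_{u,e}`. -/
instance : CoalgebraStruct k (CrossCoproduct k φ) where
  comul := (basis k φ).constr k fun p => 
    ∑ x : G, basis k φ (p.1, x) ⊗ₜ[k] basis k φ (ract φ p.1 x, x⁻¹ * p.2)
  counit := (basis k φ).constr k fun p => if p.2 = 1 then 1 else 0

theorem comul_basis (p : M × G) : CoalgebraStruct.comul (R := k) (basis k φ p) = 
    ∑ x : G, basis k φ (p.1, x) ⊗ₜ[k] basis k φ (ract φ p.1 x, x⁻¹ * p.2) :=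
  Module.Basis.constr_basis ..

theorem counit_basis (p : M × G) : CoalgebraStruct.counit (R := k) (basis k φ p) =
    if p.2 = 1 then 1 else 0 :=
  Module.Basis.constr_basis ..

instance : Coalgebra k (CrossCoproduct k φ) where
  coassoc := (basis k φ).ext fun p => by
    simp only [LinearMap.comp_apply, comul_basis, map_sum, LinearMap.rTensor_tmul,
      LinearMap.lTensor_tmul, TensorProduct.sum_tmul, TensorProduct.tmul_sum,
      LinearEquiv.coe_coe, TensorProduct.assoc_tmul]
    rw [Finset.sum_comm]
    refine Finset.sum_congr rfl fun b _ => ?_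
    refine Fintype.sum_equiv (Equiv.mulLeft b⁻¹) _ _ fun c => ?_
    simp [mul_assoc]
  rTensor_counit_comp_comul := (basis k φ).ext fun p => by
    simp [comul_basis, counit_basis, ite_tmul]
  lTensor_counit_comp_comul := (basis k φ).ext fun p => by
    simp [comul_basis, counit_basis, inv_mul_eq_one, tmul_ite]

instance : Bialgebra k (CrossCoproduct k φ) where
  counit_one := by
    simp [one_def, counit_basis]
  mul_compr₂_counit := (basis k φ).ext fun p => (basis k φ).ext fun q => by
    obtain ⟨s, u⟩ := p
    obtain ⟨t, v⟩ := q
    simp only [LinearMap.compr₂_apply, LinearMap.mul_apply', LinearMap.compl₁₂_apply,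
      basis_mul_basis, counit_basis]
    by_cases h : u = v
    · subst h
      by_cases h1 : u = 1 <;> simp [h1, counit_basis]
    · by_cases h1 : u = 1
      · subst h1
        have : v ≠ 1 := fun h2 => h h2.symm
        simp [h, this]
      · simp [h, h1]
  comul_one := by
    simp only [one_def, map_sum, comul_basis, Algebra.TensorProduct.one_def,
      TensorProduct.sum_tmul, TensorProduct.tmul_sum]
    rw [Finset.sum_comm]
    conv_rhs => rw [Finset.sum_comm]
    refine Finset.sum_congr rfl fun b _ => ?_
    exact Fintype.sum_equiv (Equiv.mulLeft b⁻¹) _ _ fun c => by simp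
  mul_compr₂_comul := (basis k φ).ext fun p => (basis k φ).ext fun q => by
    obtain ⟨s, u⟩ := p
    obtain ⟨t, v⟩ := q
    simp only [LinearMap.compr₂_apply, LinearMap.mul_apply', LinearMap.compl₁₂_apply,
      comul_basis, Finset.sum_mul_sum, Algebra.TensorProduct.tmul_mul_tmul, basis_mul_basis]
    have h1 : ∀ x y : G, ((if x = y then basis k φ (s * t, y) else 0) ⊗ₜ[k]
        (if x⁻¹ * u = y⁻¹ * v then basis k φ (ract φ s x * ract φ t y, y⁻¹ * v) else 0)) =
        if x = y then (if u = v then basis k φ (s * t, x) ⊗ₜ[k]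
          basis k φ (ract φ (s * t) x, x⁻¹ * v) else 0) else 0 := fun x y => by
      by_cases hc : x = y
      · subst hc
        simp [mul_ract, tmul_ite]
      · simp [hc]
    simp only [h1, Finset.sum_ite_eq, Finset.mem_univ, if_true]
    split_ifs with h
    · exact comul_basis k φ (s * t, v)
    · simp

/-- The antipode `S(s ⊗ δ_u) = (s ◁ u)⁻¹ ⊗ δ_{u⁻¹}`. -/
instance : HopfAlgebra k (CrossCoproduct k φ) where
  antipode := (basis k φ).constr k fun p => basis k φ ((ract φ p.1 p.2)⁻¹, p.2⁻¹)
  mul_antipode_rTensor_comul := (basis k φ).ext fun p => by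
    obtain ⟨s, u⟩ := p
    simp only [LinearMap.comp_apply, comul_basis, map_sum, LinearMap.rTensor_tmul,
      Module.Basis.constr_basis, LinearMap.mul'_apply, basis_mul_basis, counit_basis]
    have h0 : ∀ x : G, x⁻¹ = x⁻¹ * u ↔ u = 1 := fun x => by simp
    simp only [h0, Algebra.linearMap_apply]
    by_cases hs : u = 1
    · subst hs
      simp only [if_true, mul_one, inv_mul_cancel, map_one, one_def]
      exact Fintype.sum_equiv (Equiv.inv G) _ _ fun c => rfl
    · simp [hs]
  mul_antipode_lTensor_comul := (basis k φ).ext fun p => by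
    obtain ⟨s, u⟩ := p
    simp only [LinearMap.comp_apply, comul_basis, map_sum, LinearMap.lTensor_tmul,
      Module.Basis.constr_basis, LinearMap.mul'_apply, basis_mul_basis, counit_basis]
    have h0 : ∀ x : G, x = (x⁻¹ * u)⁻¹ ↔ u = 1 := fun x => by simp
    simp only [h0, Algebra.linearMap_apply]
    by_cases hs : u = 1
    · subst hs
      simp [one_def]
    · simp [hs]

end CrossCoproduct

namespace CrossProduct

variable {k} (φ : G →* MulAut M) [Fintype M]

/-- The inclusion `k(M) ⊆ k(M) ⋊ kG`, `f ↦ ∑_s f(s) δ_s ⊗ e`. -/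
def ofFun : (M → k) →ₐ[k] CrossProduct k φ :=
  AlgHom.ofLinearMap
    { toFun := fun f => ∑ s : M, f s • basis k φ (s, 1)
      map_add' := fun f g => by simp [add_smul, Finset.sum_add_distrib]
      map_smul' := fun r f => by simp [mul_smul, Finset.smul_sum] }
    (by simp [one_def])
    (fun f g => by
      simp [Finset.sum_mul_sum, basis_mul_basis, smul_smul, mul_comm])

variable (k) in
/-- The element `u = ∑_s δ_s ⊗ u` of `k(M) ⋊ kG` defined by `u ∈ G`. -/
def ofGroup (u : G) : CrossProduct k φ := ∑ s : M, basis k φ (s, u)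

end CrossProduct

/-- The quantum double `D(G) = k(G) ⋊ kG` of a group: the cross product by the conjugation action,
that is `(δ_s ⊗ u)(δ_t ⊗ v) = δ_{u⁻¹su, t} (δ_s ⊗ uv)`. -/
abbrev QuantumDouble (k : Type*) [Field k] (G : Type*) [Group G] : Type _ :=
  CrossProduct k (MulAut.conj : G →* MulAut G)

/-- The evaluation pairing between `k(M) ⋊ kG` and its dual,
`⟨δ_s ⊗ u, t ⊗ δ_v⟩ = δ_{s,t} δ_{u,v}`. -/
def pairing (φ : G →* MulAut M) : CrossProduct k φ →ₗ[k] CrossCoproduct k φ →ₗ[k] k :=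
  (CrossProduct.basis k φ).constr k fun p => (CrossCoproduct.basis k φ).constr k fun q =>
    if p = q then 1 else 0

end HopfAlgebras

section TangentSpaces

variable {k : Type*} [Field k] {H : Type*} [Ring H] [HopfAlgebra k H]

/-- The right quantum adjoint action of `h`, `g ↦ g ◁ h = ∑ S(h₁) g h₂`. -/
def adAction (h : H) : H →ₗ[k] H :=
  TensorProduct.lift ((LinearMap.mul k (Module.End k H)).compl₁₂
    (LinearMap.mul k H ∘ₗ HopfAlgebraStruct.antipode k) (LinearMap.mul k H).flip)
    (CoalgebraStruct.comul (R := k) h)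

/-- The coregular action of a functional `f ∈ H*` on `H`, `h ↦ ∑ h₁ f(h₂)`. -/
def coregAction (f : Module.Dual k H) : H →ₗ[k] H :=
  (TensorProduct.rid k H).toLinearMap ∘ₗ f.lTensor H ∘ₗ CoalgebraStruct.comul

/-- The action of a functional `f ∈ H*` on the augmentation ideal `H⁺ = ker ε`,
`h ↦ ∑ h₁ f(h₂) - f(h) 1`. -/
def coregActionPlus (f : Module.Dual k H) : H →ₗ[k] H :=
  coregAction f - f.smulRight (1 : H)

variable (k H) in
/-- A quantum tangent space: a subspace of `H⁺ = ker ε` stable under the quantum double `D(H)`, that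
is, under the right adjoint action of `H` and the action of `H*`. -/
structure QuantumTangentSpace extends Submodule k H where
  counit_eq_zero : ∀ h ∈ toSubmodule, CoalgebraStruct.counit (R := k) h = 0
  adAction_mem : ∀ g : H, ∀ h ∈ toSubmodule, adAction (k := k) g h ∈ toSubmodule
  coregActionPlus_mem : ∀ f : Module.Dual k H, ∀ h ∈ toSubmodule,
    coregActionPlus f h ∈ toSubmodule

namespace QuantumTangentSpace

/-- Irreducibility of a quantum tangent space, as a `D(H)`-submodule of `H⁺`. -/
def IsIrreducible (L : QuantumTangentSpace k H) : Prop :=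
  L.toSubmodule ≠ ⊥ ∧ ∀ L' : QuantumTangentSpace k H, L'.toSubmodule ≤ L.toSubmodule →
    L'.toSubmodule = ⊥ ∨ L'.toSubmodule = L.toSubmodule

variable (L : QuantumTangentSpace k H)

/-- The space `Λ¹ = L*` of invariant 1-forms. -/
abbrev InvForms : Type _ := Module.Dual k L.toSubmodule

/-- The action of `H*` on `L`. -/
def act (f : Module.Dual k H) : L.toSubmodule →ₗ[k] L.toSubmodule :=
  (coregActionPlus f).restrict (L.coregActionPlus_mem f)

variable {A : Type*} [Ring A] [HopfAlgebra k A] (p : A →ₗ[k] H →ₗ[k] k)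

/-- The right action of `A` on `Λ¹`, adjoint to the action of `A` on `L` through the pairing `p` of
`A` with `H`: `⟨x ◁ a, l⟩ = ⟨x, l ◁ a⟩`. -/
def formAction : A →ₗ[k] L.InvForms →ₗ[k] L.InvForms where
  toFun a := (L.act (p a)).dualMap
  map_add' a b := by
    ext x l
    have : L.act (p (a + b)) l = L.act (p a) l + L.act (p b) l := by
      ext
      simp [act, coregActionPlus, coregAction, LinearMap.lTensor_add, add_smul]
      abel
    rw [LinearMap.dualMap_apply, this, map_add]
    rfl
  map_smul' r a := by
    ext x l
    have : L.act (p (r • a)) l = r • L.act (p a) l := by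
      ext
      simp [act, coregActionPlus, coregAction, LinearMap.lTensor_smul, smul_sub, mul_smul]
    rw [LinearMap.dualMap_apply, this, map_smul]
    rfl

/-- The bimodule of 1-forms `Ω¹ = A ⊗ Λ¹`. -/
abbrev Omega (A : Type*) [Ring A] [HopfAlgebra k A] (L : QuantumTangentSpace k H) : Type _ :=
  A ⊗[k] L.InvForms

/-- Left multiplication on `Ω¹`: `a · (b ⊗ x) = ab ⊗ x`. -/
def leftMul : A →ₗ[k] L.Omega A →ₗ[k] L.Omega A :=
  LinearMap.rTensorHom L.InvForms ∘ₗ LinearMap.mul k A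

/-- Right multiplication on `Ω¹`; `rightMul a` is the map `b ⊗ x ↦ (b ⊗ x) · a = ∑ b a₁ ⊗ (x ◁ a₂)`. -/
def rightMul : A →ₗ[k] L.Omega A →ₗ[k] L.Omega A :=
  TensorProduct.map₂ (LinearMap.mul k A).flip (L.formAction p) ∘ₗ CoalgebraStruct.comul

/-- The map `A → A⁺ → Λ¹`, `a ↦ π(a - ε(a)1)`, where `π` is adjoint to the inclusion
`L ⊆ H⁺`. -/
def proj : A →ₗ[k] L.InvForms :=
  (L.toSubmodule.subtype.dualMap ∘ₗ p) ∘ₗ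
    (LinearMap.id - Algebra.linearMap k A ∘ₗ CoalgebraStruct.counit)

/-- The exterior derivative `da = ∑ a₁ ⊗ π(a₂ - ε(a₂)1)`. -/
def d : A →ₗ[k] L.Omega A :=
  (L.proj p).lTensor A ∘ₗ CoalgebraStruct.comul

end QuantumTangentSpace

end TangentSpaces

section Calculi

variable {k : Type*} [Field k] {A : Type*} [Ring A] {Ω : Type*} [AddCommGroup Ω] [Module k Ω]

/-- `(Ω, d)` is a differential calculus over the `k`-algebra `A`. The bimodule structure is given by
`l a ω = a ω` and `r a ω = ω a`. -/
structure IsDifferentialCalculus [Algebra k A] (l r : A →ₗ[k] Ω →ₗ[k] Ω) (d : A →ₗ[k] Ω) :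
    Prop where
  one_left : ∀ ω, l 1 ω = ω
  mul_left : ∀ a b ω, l (a * b) ω = l a (l b ω)
  one_right : ∀ ω, r 1 ω = ω
  mul_right : ∀ a b ω, r (a * b) ω = r b (r a ω)
  left_right : ∀ a b ω, r b (l a ω) = l a (r b ω)
  leibniz : ∀ a b, d (a * b) = l a (d b) + r b (d a)
  surjective : Submodule.span k {ω | ∃ a b, ω = l a (d b)} = ⊤

/-- `(Ω, d)` is a bicovariant differential calculus over the Hopf algebra `A`: `Ω` is an
`A`-`A`-bicomodule via bimodule maps, and `d` is a bicomodule map. -/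
structure IsBicovariantCalculus [HopfAlgebra k A] (l r : A →ₗ[k] Ω →ₗ[k] Ω) (d : A →ₗ[k] Ω) :
    Prop extends IsDifferentialCalculus l r d where
  bicovariant : ∃ (ΔL : Ω →ₗ[k] A ⊗[k] Ω) (ΔR : Ω →ₗ[k] Ω ⊗[k] A),
    -- left comodule
    ((TensorProduct.assoc k A A Ω).toLinearMap ∘ₗ
      (CoalgebraStruct.comul (R := k) (A := A)).rTensor Ω ∘ₗ ΔL = ΔL.lTensor A ∘ₗ ΔL) ∧
    ((TensorProduct.lid k Ω).toLinearMap ∘ₗ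
      (CoalgebraStruct.counit (R := k) (A := A)).rTensor Ω ∘ₗ ΔL = LinearMap.id) ∧
    -- right comodule
    ((TensorProduct.assoc k Ω A A).toLinearMap ∘ₗ ΔR.rTensor A ∘ₗ ΔR =
      (CoalgebraStruct.comul (R := k) (A := A)).lTensor Ω ∘ₗ ΔR) ∧
    ((TensorProduct.rid k Ω).toLinearMap ∘ₗ
      (CoalgebraStruct.counit (R := k) (A := A)).lTensor Ω ∘ₗ ΔR = LinearMap.id) ∧
    -- commuting coactions
    ((TensorProduct.assoc k A Ω A).toLinearMap ∘ₗ ΔL.rTensor A ∘ₗ ΔR =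
      ΔR.lTensor A ∘ₗ ΔL) ∧
    -- the coactions are bimodule maps
    (∀ a ω, ΔL (l a ω) = TensorProduct.map₂ (LinearMap.mul k A) l
      (CoalgebraStruct.comul (R := k) a) (ΔL ω)) ∧
    (∀ a ω, ΔL (r a ω) = TensorProduct.map₂ (LinearMap.mul k A).flip r
      (CoalgebraStruct.comul (R := k) a) (ΔL ω)) ∧
    (∀ a ω, ΔR (l a ω) = TensorProduct.map₂ l (LinearMap.mul k A)
      (CoalgebraStruct.comul (R := k) a) (ΔR ω)) ∧
    (∀ a ω, ΔR (r a ω) = TensorProduct.map₂ r (LinearMap.mul k A).flip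
      (CoalgebraStruct.comul (R := k) a) (ΔR ω)) ∧
    -- `d` is a bicomodule map
    ΔL ∘ₗ d = d.lTensor A ∘ₗ CoalgebraStruct.comul ∧
    ΔR ∘ₗ d = d.rTensor A ∘ₗ CoalgebraStruct.comul

end Calculi

namespace GroupCalculus

/-! The calculus on `k(M)` defined by a conjugacy class `C` of `M`: a 1-form `∑_a ω_a e_a` is the
family of its coefficients, `ω : C → k(M)`, with relations `e_a f = R_a(f) e_a` and
`df = ∑_a (R_a(f) - f) e_a`, where `R_a(f)(x) = f(xa)`. -/

variable (k : Type*) [Field k] {M : Type*} [Group M] (C : Set M)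

/-- Left multiplication `f · ω`. -/
def leftMul : (M → k) →ₗ[k] (C → M → k) →ₗ[k] (C → M → k) :=
  LinearMap.mk₂ k (fun f ω a x => f x * ω a x)
    (fun f g ω => by ext; simp [add_mul]) (fun r f ω => by ext; simp [mul_assoc])
    (fun f ω η => by ext; simp [mul_add]) (fun r f ω => by ext; simp [mul_left_comm])

/-- Right multiplication by `f`, `ω ↦ ω · f`. -/
def rightMul : (M → k) →ₗ[k] (C → M → k) →ₗ[k] (C → M → k) :=
  LinearMap.mk₂ k (fun f ω a x => ω a x * f (x * a))
    (fun f g ω => by ext; simp [mul_add]) (fun r f ω => by ext; simp [mul_left_comm])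
    (fun f ω η => by ext; simp [add_mul]) (fun r f ω => by ext; simp [mul_assoc])

/-- The exterior derivative. -/
def d : (M → k) →ₗ[k] (C → M → k) where
  toFun f := fun a x => f (x * a) - f x
  map_add' f g := by ext; simp; ring
  map_smul' r f := by ext; simp [mul_sub]

end GroupCalculus

/-- `W` is a non-zero subspace that is stable under all the operators in `S`, and has no proper
non-zero subspace stable under them. -/
structure IsIrreducibleUnder {k V : Type*} [Field k] [AddCommGroup V] [Module k V]
    (S : Set (V →ₗ[k] V)) (W : Submodule k V) : Prop where
  ne_bot : W ≠ ⊥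
  stable : ∀ T ∈ S, ∀ w ∈ W, T w ∈ W
  minimal : ∀ W' ≤ W, (∀ T ∈ S, ∀ w ∈ W', T w ∈ W') → W' = ⊥ ∨ W' = W

section CrossedModule

variable (k : Type*) [Field k] {G M : Type*} [Group G] [Group M] {φ : G →* MulAut M}

/-- The factor `t ∈ M` in the factorization `x = v t` of `x ∈ X`, `v ∈ G`. The factor `v` is
`x.right`. -/
def mFactor (x : M ⋊[φ] G) : M := ract φ x.left x.right

theorem inr_mul_inl_mFactor (x : M ⋊[φ] G) : inr x.right * inl (mFactor x) = x := by
  ext <;> simp [mFactor, ract]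

/-- The `X`-degree `‖vt‖ = v⁻¹ t⁻¹ v`. -/
def xDegree (x : M ⋊[φ] G) : M ⋊[φ] G :=
  (inr x.right)⁻¹ * (inl (mFactor x))⁻¹ * inr x.right

/-- The right action of `us` on `vt` in `X`, `(vt, us) ↦ vu (s̃ t s̃⁻¹)` with
`s̃ = s⁻¹ ◁ (vu)⁻¹`. -/
def xAct (x y : M ⋊[φ] G) : M ⋊[φ] G :=
  inr (x.right * y.right) *
    inl (ract φ (mFactor y)⁻¹ (x.right * y.right)⁻¹ * mFactor x *
      (ract φ (mFactor y)⁻¹ (x.right * y.right)⁻¹)⁻¹)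

/-- The action of `y ∈ X` on the vector space `kX`. -/
def kxAct (y : M ⋊[φ] G) : ((M ⋊[φ] G) →₀ k) →ₗ[k] ((M ⋊[φ] G) →₀ k) :=
  Finsupp.lmapDomain k k fun x => xAct x y

/-- The projection of `kX` onto its component of degree `z`. -/
def kxProj (z : M ⋊[φ] G) : ((M ⋊[φ] G) →₀ k) →ₗ[k] ((M ⋊[φ] G) →₀ k) :=
  Finsupp.linearCombination k fun x => if xDegree x = z then Finsupp.single x 1 else 0

/-- The component `J_z` of `kX` of degree `z`. -/
def kxHomogeneous (z : M ⋊[φ] G) : Submodule k ((M ⋊[φ] G) →₀ k) :=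
  Finsupp.supported k k {x | xDegree x = z}

variable (φ) in
/-- The operators of the quantum double `D(X) = k(X) ⋊ kX` on `kX`: `δ_z ⊗ y` acts as the projection
to degree `z` followed by the action of `y`. -/
def doubleOperators : Set (((M ⋊[φ] G) →₀ k) →ₗ[k] ((M ⋊[φ] G) →₀ k)) :=
  Set.range fun q : (M ⋊[φ] G) × (M ⋊[φ] G) => kxAct k q.2 ∘ₗ kxProj k q.1

variable (φ) in
/-- The identification of `kX` with `H`, `vt ≡ t ⊗ δ_v`. -/
def toH : ((M ⋊[φ] G) →₀ k) →ₗ[k] CrossCoproduct k φ :=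
  Finsupp.linearCombination k fun x => CrossCoproduct.basis k φ (mFactor x, x.right)

variable [Fintype G]

variable (φ) in
/-- The map `Π : kX → H⁺`, `vt ↦ t ⊗ δ_v - ε(t ⊗ δ_v) 1`. -/
def toHPlus : ((M ⋊[φ] G) →₀ k) →ₗ[k] CrossCoproduct k φ :=
  (LinearMap.id - Algebra.linearMap k (CrossCoproduct k φ) ∘ₗ CoalgebraStruct.counit) ∘ₗ toH k φ

variable (φ) in
/-- The vector `f_a = ∑_{v ∈ G} v (a⁻¹ ◁ v⁻¹)` of `kX`. -/
def tangentVector (a : M) : (M ⋊[φ] G) →₀ k :=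
  ∑ v : G, Finsupp.single (inr v * inl (ract φ a⁻¹ v⁻¹)) 1

variable (φ) in
/-- The subspace `𝓜 = ∑_{a ∈ C} k f_a` of `kX`. -/
def canonicalSubspace (C : Set M) : Submodule k ((M ⋊[φ] G) →₀ k) :=
  ⨆ a ∈ C, Submodule.span k {tangentVector k φ a}

end CrossedModule

end

noncomputable section

/-! Everything rests on how the vectors f_a move. Each f_a is homogeneous of degree a, and y ∈ X
carries it to f_{y⁻¹ay} (`kxAct_tangentVector`), so 𝓜 is the span of C, permuted by conjugation and
graded by C itself. A non-zero stable subspace contains some f_a, by projecting to a degree, and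
then all of them, by transitivity (`Submodule.eq_bot_or_eq_span_of_proj`).

The same picture holds in H. The adjoint action of t ⊗ δ_v sends f_a to f_{t⁻¹at} if v = e and to 0
otherwise; a functional sends f_a to a combination of the f_{a◁y⁻¹}. Since f_e = 1 in H, Π(f_a) =
f_a − f_e, and both formulas pass to the Π(f_a). The coordinate functionals at a⁻¹ ⊗ δ_e act on Π(𝓜)
as projections, so the irreducibility argument repeats; they also show that the Π(f_a) are
independent, as e ∉ C.

Dually, e_b ◁ (δ_s ⊗ u) is e_{b◁u} if s = b⁻¹ and 0 otherwise, whence e_b(δ_s ⊗ u) = (δ_{sb} ⊗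
u)e_{b◁u}. The differential is then inner: da = θa − aθ with θ = ∑ e_b (`CrossProduct.d_eq`). The
Leibniz rule is formal, and d is a bicomodule map because θ is invariant under both coactions.
Bicovariance is proved for any l, r, d on a free left module that satisfy these basis formulas; the
canonical calculus is shown to satisfy them afterwards.

On k(M) the rule becomes e_b f = R_{b⁻¹}(f)e_b, which is why the restriction belongs to C⁻¹. The
quantum double is the case of the conjugation action. -/

theorem Module.Basis.induction_span {ι k V : Type*} [Field k] [AddCommGroup V] [Module k V]
    (b : Module.Basis ι k V) {P : V → Prop} (basis : ∀ i, P (b i)) (zero : P 0)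
    (add : ∀ x y, P x → P y → P (x + y)) (smul : ∀ (r : k) x, P x → P (r • x)) (x : V) : P x :=
  Submodule.span_induction (fun _ ⟨i, hi⟩ => hi ▸ basis i) zero (fun x y _ _ => add x y)
    (fun r x _ => smul r x) (b.mem_span x)

/-! ### Bimodule and bicomodule structure on 1-forms over k(M) ⋊ kG. -/

namespace CrossProduct

variable {k : Type*} [Field k] {G M : Type*} [Group G] [Group M] [Fintype M] {φ : G →* MulAut M}
  {C : Set M} {V : Type*} [AddCommGroup V] [Module k V] (e : Module.Basis C k V)

variable (φ) in
/-- The basis `(δ_s ⊗ u) e_b` of the left module of 1-forms. -/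
def formBasis : Module.Basis ((M × G) × C) k (CrossProduct k φ ⊗[k] V) :=
  (basis k φ).tensorProduct e

theorem formBasis_apply (p : M × G) (b : C) : formBasis φ e (p, b) = basis k φ p ⊗ₜ[k] e b :=
  Module.Basis.tensorProduct_apply ..

variable (φ) in
/-- The left coaction on 1-forms, for which the `e_b` are invariant. -/
def leftCoaction : CrossProduct k φ ⊗[k] V →ₗ[k]
    CrossProduct k φ ⊗[k] (CrossProduct k φ ⊗[k] V) :=
  (TensorProduct.assoc k _ _ V).toLinearMap ∘ₗ CoalgebraStruct.comul.rTensor V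

theorem leftCoaction_basis (p : M × G) (b : C) : leftCoaction φ (basis k φ p ⊗ₜ[k] e b) =
    ∑ y : M, basis k φ (p.1 * y⁻¹, p.2) ⊗ₜ[k] (basis k φ (y, p.2) ⊗ₜ[k] e b) := by
  simp [leftCoaction, comul_basis, TensorProduct.sum_tmul]

/-- The action of `M` on `C` by conjugation. -/
def conjMem (hM : ∀ a ∈ C, ∀ t : M, t * a * t⁻¹ ∈ C) (t : M) (a : C) : C :=
  ⟨t * a * t⁻¹, hM a a.2 t⟩

variable (φ) in
/-- The right coaction on 1-forms, determined by `e_b ↦ ∑_t e_{tbt⁻¹} ⊗ δ_t`. -/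
def rightCoaction (hM : ∀ a ∈ C, ∀ t : M, t * a * t⁻¹ ∈ C) : CrossProduct k φ ⊗[k] V →ₗ[k]
    (CrossProduct k φ ⊗[k] V) ⊗[k] CrossProduct k φ :=
  (formBasis φ e).constr k fun q =>
    ∑ y : M, (basis k φ (q.1.1 * y⁻¹, q.1.2) ⊗ₜ[k] e (conjMem hM (ract φ y q.1.2) q.2)) ⊗ₜ[k] basis k φ (y, q.1.2)

/-- The index (y ◁ u)b(y ◁ u)⁻¹ comes from Δ(δ_s ⊗ u) · ∑_t e_{tbt⁻¹} ⊗ δ_t: the product (δ_y ⊗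
u)δ_t is non-zero only for t = y ◁ u. -/
theorem rightCoaction_basis (hM : ∀ a ∈ C, ∀ t : M, t * a * t⁻¹ ∈ C) (p : M × G) (b : C) :
    rightCoaction φ e hM (basis k φ p ⊗ₜ[k] e b) =
    ∑ y : M, (basis k φ (p.1 * y⁻¹, p.2) ⊗ₜ[k] e (conjMem hM (ract φ y p.2) b)) ⊗ₜ[k] basis k φ (y, p.2) := by
  rw [← formBasis_apply, rightCoaction, Module.Basis.constr_basis]

include e in
theorem leftCoaction_coassoc : (TensorProduct.assoc k (CrossProduct k φ) (CrossProduct k φ)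
      (CrossProduct k φ ⊗[k] V)).toLinearMap ∘ₗ
      (CoalgebraStruct.comul (R := k) (A := CrossProduct k φ)).rTensor _ ∘ₗ leftCoaction φ =
      (leftCoaction φ).lTensor _ ∘ₗ leftCoaction φ (V := V) := by
  refine (formBasis φ e).ext fun ⟨⟨s, u⟩, b⟩ => ?_
  simp only [formBasis_apply, LinearMap.comp_apply, leftCoaction_basis, map_sum,
    LinearMap.rTensor_tmul, LinearMap.lTensor_tmul, comul_basis, TensorProduct.sum_tmul,
    TensorProduct.tmul_sum, LinearEquiv.coe_coe, TensorProduct.assoc_tmul]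
  conv_rhs => rw [Finset.sum_comm]
  refine Finset.sum_congr rfl fun b _ => ?_
  refine Fintype.sum_equiv (Equiv.mulRight b) _ _ fun c => ?_
  simp [mul_assoc]

include e in
theorem leftCoaction_counit : (TensorProduct.lid k (CrossProduct k φ ⊗[k] V)).toLinearMap ∘ₗ
      (CoalgebraStruct.counit (R := k) (A := CrossProduct k φ)).rTensor _ ∘ₗ leftCoaction φ =
      LinearMap.id := by
  refine (formBasis φ e).ext fun ⟨⟨s, u⟩, b⟩ => ?_
  simp [formBasis_apply, leftCoaction_basis, counit_basis, mul_inv_eq_one]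

theorem rightCoaction_coassoc (hM : ∀ a ∈ C, ∀ t : M, t * a * t⁻¹ ∈ C) :
    (TensorProduct.assoc k (CrossProduct k φ ⊗[k] V) (CrossProduct k φ)
      (CrossProduct k φ)).toLinearMap ∘ₗ (rightCoaction φ e hM).rTensor _ ∘ₗ rightCoaction φ e hM =
      (CoalgebraStruct.comul (R := k) (A := CrossProduct k φ)).lTensor _ ∘ₗ
        rightCoaction φ e hM := by
  refine (formBasis φ e).ext fun ⟨⟨s, u⟩, b⟩ => ?_
  simp only [formBasis_apply, LinearMap.comp_apply, rightCoaction_basis, map_sum,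
    LinearMap.rTensor_tmul, LinearMap.lTensor_tmul, comul_basis, TensorProduct.sum_tmul,
    TensorProduct.tmul_sum, LinearEquiv.coe_coe, TensorProduct.assoc_tmul]
  conv_rhs => rw [Finset.sum_comm]
  refine Finset.sum_congr rfl fun b _ => ?_
  refine Fintype.sum_equiv (Equiv.mulRight b) _ _ fun c => ?_
  simp [mul_assoc, conjMem, mul_ract]

theorem rightCoaction_counit (hM : ∀ a ∈ C, ∀ t : M, t * a * t⁻¹ ∈ C) :
    (TensorProduct.rid k (CrossProduct k φ ⊗[k] V)).toLinearMap ∘ₗ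
      (CoalgebraStruct.counit (R := k) (A := CrossProduct k φ)).lTensor _ ∘ₗ
        rightCoaction φ e hM = LinearMap.id := by
  refine (formBasis φ e).ext fun ⟨⟨s, u⟩, b⟩ => ?_
  simp [formBasis_apply, rightCoaction_basis, counit_basis, conjMem, tmul_ite]

include e in
theorem leftCoaction_rightCoaction (hM : ∀ a ∈ C, ∀ t : M, t * a * t⁻¹ ∈ C) :
    (TensorProduct.assoc k (CrossProduct k φ) (CrossProduct k φ ⊗[k] V)
      (CrossProduct k φ)).toLinearMap ∘ₗ (leftCoaction φ).rTensor _ ∘ₗ rightCoaction φ e hM =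
      (rightCoaction φ e hM).lTensor _ ∘ₗ leftCoaction φ := by
  refine (formBasis φ e).ext fun ⟨⟨s, u⟩, b⟩ => ?_
  simp only [formBasis_apply, LinearMap.comp_apply, rightCoaction_basis, leftCoaction_basis,
    map_sum, LinearMap.rTensor_tmul, LinearMap.lTensor_tmul, TensorProduct.sum_tmul,
    TensorProduct.tmul_sum, LinearEquiv.coe_coe, TensorProduct.assoc_tmul]
  conv_rhs => rw [Finset.sum_comm]
  refine Finset.sum_congr rfl fun b _ => ?_
  refine Fintype.sum_equiv (Equiv.mulRight b) _ _ fun c => ?_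
  simp [mul_assoc]

/-- With the coactions written as Δ(a) followed by the insertion of invariant forms, here and in
`rightCoaction_tmul`, compatibility with left multiplication reduces to multiplicativity of Δ. -/
theorem leftCoaction_tmul (a : CrossProduct k φ) (v : V) : leftCoaction φ (a ⊗ₜ[k] v) =
    ((TensorProduct.mk k (CrossProduct k φ) V).flip v).lTensor (CrossProduct k φ)
      (CoalgebraStruct.comul (R := k) a) := by
  rw [leftCoaction, LinearMap.comp_apply, LinearMap.rTensor_tmul]
  induction CoalgebraStruct.comul (R := k) a using TensorProduct.induction_on with
  | zero => simp
  | tmul x y => simp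
  | add x y hx hy => simp only [TensorProduct.add_tmul, map_add, hx, hy]

theorem rightCoaction_tmul (hM : ∀ a ∈ C, ∀ t : M, t * a * t⁻¹ ∈ C) (a : CrossProduct k φ)
    (b : C) : rightCoaction φ e hM (a ⊗ₜ[k] e b) =
    ∑ t : M, ((TensorProduct.mk k (CrossProduct k φ) V).flip (e (conjMem hM t b))).rTensor
      (CrossProduct k φ) (CoalgebraStruct.comul (R := k) a * 1 ⊗ₜ basis k φ (t, 1)) := by
  induction a using (basis k φ).induction_span with
  | basis p =>
    obtain ⟨s, u⟩ := p
    simp only [rightCoaction_basis, comul_basis, Finset.sum_mul, map_sum,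
      Algebra.TensorProduct.tmul_mul_tmul, mul_one, basis_mul_basis, tmul_ite,
      apply_ite (LinearMap.rTensor _ _), map_zero, LinearMap.rTensor_tmul, LinearMap.flip_apply,
      TensorProduct.mk_apply]
    rw [Finset.sum_comm]
    simp
  | zero => simp
  | add x y hx hy => simp only [map_add, TensorProduct.add_tmul, hx, hy, add_mul,
      Finset.sum_add_distrib]
  | smul c x hx => simp only [map_smul, ← TensorProduct.smul_tmul', hx, smul_mul_assoc,
      Finset.smul_sum]

/-- The action of `G` on `C`. -/
def ractMem (hG : ∀ a ∈ C, ∀ u : G, ract φ a u ∈ C) (a : C) (u : G) : C :=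
  ⟨ract φ a u, hG a a.2 u⟩

variable {l r : CrossProduct k φ →ₗ[k] CrossProduct k φ ⊗[k] V →ₗ[k] CrossProduct k φ ⊗[k] V}
  {d : CrossProduct k φ →ₗ[k] CrossProduct k φ ⊗[k] V}

theorem map₂_lTensor_mk (hl : ∀ a b v, l a (b ⊗ₜ v) = (a * b) ⊗ₜ v) (v : V)
    (x y : CrossProduct k φ ⊗[k] CrossProduct k φ) :
    TensorProduct.map₂ (LinearMap.mul k (CrossProduct k φ)) l x
      (((TensorProduct.mk k (CrossProduct k φ) V).flip v).lTensor _ y) =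
    ((TensorProduct.mk k (CrossProduct k φ) V).flip v).lTensor _ (x * y) := by
  induction x using TensorProduct.induction_on with
  | zero => simp
  | add x x' hx hx' => simp only [map_add, LinearMap.add_apply, add_mul, hx, hx']
  | tmul a b =>
    induction y using TensorProduct.induction_on with
    | zero => simp
    | add x x' hx hx' => simp only [map_add, mul_add, hx, hx']
    | tmul a b => simp [hl]

theorem map₂_rTensor_mk (hl : ∀ a b v, l a (b ⊗ₜ v) = (a * b) ⊗ₜ v) (v : V)
    (x y : CrossProduct k φ ⊗[k] CrossProduct k φ) :
    TensorProduct.map₂ l (LinearMap.mul k (CrossProduct k φ)) x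
      (((TensorProduct.mk k (CrossProduct k φ) V).flip v).rTensor _ y) =
    ((TensorProduct.mk k (CrossProduct k φ) V).flip v).rTensor _ (x * y) := by
  induction x using TensorProduct.induction_on with
  | zero => simp
  | add x x' hx hx' => simp only [map_add, LinearMap.add_apply, add_mul, hx, hx']
  | tmul a b =>
    induction y using TensorProduct.induction_on with
    | zero => simp
    | add x x' hx hx' => simp only [map_add, mul_add, hx, hx']
    | tmul a b => simp [hl]

/-- Induction over 1-forms, starting from the forms `a e_b`. -/
theorem form_induction {P : CrossProduct k φ ⊗[k] V → Prop} (tmul : ∀ a b, P (a ⊗ₜ e b))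
    (zero : P 0) (add : ∀ x y, P x → P y → P (x + y)) (ω : CrossProduct k φ ⊗[k] V) : P ω := by
  induction ω using TensorProduct.induction_on with
  | zero => exact zero
  | add x y hx hy => exact add x y hx hy
  | tmul a v =>
    induction v using e.induction_span generalizing a with
    | basis b => exact tmul a b
    | zero => simpa using zero
    | add x y hx hy => rw [TensorProduct.tmul_add]; exact add _ _ (hx a) (hy a)
    | smul c x hx => rw [← TensorProduct.smul_tmul]; exact hx _

theorem leftCoaction_leftMul (hl : ∀ a b v, l a (b ⊗ₜ v) = (a * b) ⊗ₜ v) (a : CrossProduct k φ)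
    (ω : CrossProduct k φ ⊗[k] V) :
    leftCoaction φ (l a ω) = TensorProduct.map₂ (LinearMap.mul k (CrossProduct k φ)) l
      (CoalgebraStruct.comul (R := k) a) (leftCoaction φ ω) := by
  induction ω using TensorProduct.induction_on with
  | zero => simp
  | add x y hx hy => simp only [map_add, hx, hy]
  | tmul b v => rw [hl, leftCoaction_tmul, leftCoaction_tmul, map₂_lTensor_mk hl,
      Bialgebra.comul_mul]

theorem rightCoaction_leftMul (hM : ∀ a ∈ C, ∀ t : M, t * a * t⁻¹ ∈ C)
    (hl : ∀ a b v, l a (b ⊗ₜ v) = (a * b) ⊗ₜ v) (a : CrossProduct k φ)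
    (ω : CrossProduct k φ ⊗[k] V) :
    rightCoaction φ e hM (l a ω) = TensorProduct.map₂ l (LinearMap.mul k (CrossProduct k φ))
      (CoalgebraStruct.comul (R := k) a) (rightCoaction φ e hM ω) := by
  induction ω using form_induction e with
  | zero => simp
  | add x y hx hy => simp only [map_add, hx, hy]
  | tmul b v => simp only [hl, rightCoaction_tmul, map_sum, map₂_rTensor_mk hl,
      Bialgebra.comul_mul, mul_assoc]

section

variable (hG : ∀ a ∈ C, ∀ u : G, ract φ a u ∈ C)
  (hr : ∀ p a b, r (basis k φ p) (a ⊗ₜ e b) =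
    (a * basis k φ (p.1 * b, p.2)) ⊗ₜ e (ractMem hG b p.2))

include hr

theorem leftCoaction_rightMul (a : CrossProduct k φ) (ω : CrossProduct k φ ⊗[k] V) :
    leftCoaction φ (r a ω) = TensorProduct.map₂ (LinearMap.mul k (CrossProduct k φ)).flip r
      (CoalgebraStruct.comul (R := k) a) (leftCoaction φ ω) := by
  induction a using (basis k φ).induction_span with
  | basis p =>
    obtain ⟨s, u⟩ := p
    induction ω using form_induction e with
    | zero => simp
    | add x y hx hy => simp only [map_add, hx, hy]
    | tmul a b =>
      rw [hr, leftCoaction_tmul, leftCoaction_tmul, Bialgebra.comul_mul, comul_basis, comul_basis]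
      induction CoalgebraStruct.comul (R := k) a using TensorProduct.induction_on with
      | zero => simp
      | add x y hx hy => simp only [map_add, add_mul, hx, hy]
      | tmul x y =>
        simp only [Finset.mul_sum, map_sum, LinearMap.sum_apply,
          Algebra.TensorProduct.tmul_mul_tmul, LinearMap.lTensor_tmul, LinearMap.flip_apply,
          TensorProduct.mk_apply, TensorProduct.map₂_apply_tmul]
        -- Passing δ_c ⊗ u to the left of e_b gives δ_{cb} ⊗ u, so the summation index of Δ(δ_{sb} ⊗
        -- u) is cb.
        refine (Fintype.sum_equiv (Equiv.mulRight (b : M)) _ _ fun c => ?_).symm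
        have h := hr (c, u) y b
        rw [show s * c⁻¹ = s * b * (Equiv.mulRight (b : M) c)⁻¹ by simp]
        exact congrArg ((x * basis k φ (s * b * (Equiv.mulRight (b : M) c)⁻¹, u)) ⊗ₜ[k] ·) h
  | zero => simp
  | add x y hx hy => simp only [map_add, LinearMap.add_apply, hx, hy]
  | smul c x hx => simp only [map_smul, LinearMap.smul_apply, hx]

theorem rightMul_leftMul (hl : ∀ a b v, l a (b ⊗ₜ v) = (a * b) ⊗ₜ v) (a b : CrossProduct k φ)
    (ω : CrossProduct k φ ⊗[k] V) : r b (l a ω) = l a (r b ω) := by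
  induction b using (basis k φ).induction_span with
  | basis p =>
    induction ω using form_induction e with
    | zero => simp
    | add x y hx hy => simp only [map_add, hx, hy]
    | tmul c b => simp only [hl, hr, mul_assoc]
  | zero => simp
  | add x y hx hy => simp only [map_add, LinearMap.add_apply, hx, hy]
  | smul c x hx => simp only [map_smul, LinearMap.smul_apply, hx]

theorem rightMul_one (ω : CrossProduct k φ ⊗[k] V) : r 1 ω = ω := by
  induction ω using form_induction e with
  | zero => simp
  | add x y hx hy => simp only [map_add, hx, hy]
  | tmul a b =>
    simp only [one_def, map_sum, LinearMap.sum_apply, hr, ← TensorProduct.sum_tmul, ractMem,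
      ract_one, Subtype.coe_eta, ← Finset.mul_sum]
    -- Translation by b permutes the terms of 1 = ∑_s δ_s.
    rw [Fintype.sum_equiv (Equiv.mulRight (b : M)) (fun s => basis k φ (s * b, 1))
      (fun s => basis k φ (s, 1)) fun c => rfl, ← one_def, mul_one]

/-- The shift by b respects the product because s ◁ u = t exactly when (sb) ◁ u = t(b ◁ u). -/
theorem rightMul_mul (a b : CrossProduct k φ) (ω : CrossProduct k φ ⊗[k] V) :
    r (a * b) ω = r b (r a ω) := by
  induction a using (basis k φ).induction_span with
  | basis p =>
    induction b using (basis k φ).induction_span with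
    | basis q =>
      induction ω using form_induction e with
      | zero => simp
      | add x y hx hy => simp only [map_add, hx, hy]
      | tmul a b =>
        simp only [hr, basis_mul_basis, mul_assoc, ractMem, mul_ract, mul_left_inj]
        split_ifs with h
        · simp [hr, ractMem]
        · simp
    | zero => simp
    | add x y hx hy => simp only [map_add, mul_add, LinearMap.add_apply, hx, hy]
    | smul c x hx => simp only [map_smul, mul_smul_comm, LinearMap.smul_apply, hx]
  | zero => simp
  | add x y hx hy => simp only [map_add, add_mul, LinearMap.add_apply, hx, hy]
  | smul c x hx => simp only [map_smul, smul_mul_assoc, LinearMap.smul_apply, hx]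

theorem rightCoaction_rightMul (hM : ∀ a ∈ C, ∀ t : M, t * a * t⁻¹ ∈ C)
    (hl : ∀ a b v, l a (b ⊗ₜ v) = (a * b) ⊗ₜ v) (a : CrossProduct k φ)
    (ω : CrossProduct k φ ⊗[k] V) :
    rightCoaction φ e hM (r a ω) =
      TensorProduct.map₂ r (LinearMap.mul k (CrossProduct k φ)).flip
        (CoalgebraStruct.comul (R := k) a) (rightCoaction φ e hM ω) := by
  -- The left and right actions still commute after tensoring with A; this allows a left factor to
  -- be pulled out.
  have hlr : ∀ x y ω, TensorProduct.map₂ r (LinearMap.mul k (CrossProduct k φ)).flip y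
      (TensorProduct.map₂ l (LinearMap.mul k (CrossProduct k φ)) x ω) =
      TensorProduct.map₂ l (LinearMap.mul k (CrossProduct k φ)) x
      (TensorProduct.map₂ r (LinearMap.mul k (CrossProduct k φ)).flip y ω) := fun x y ω => by
    induction x using TensorProduct.induction_on with
    | zero => simp
    | add x x' hx hx' => simp only [map_add, LinearMap.add_apply, hx, hx']
    | tmul a b =>
      induction y using TensorProduct.induction_on with
      | zero => simp
      | add x x' hx hx' => simp only [map_add, LinearMap.add_apply, hx, hx']
      | tmul a' b' =>
        induction ω using TensorProduct.induction_on with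
        | zero => simp
        | add x x' hx hx' => simp only [map_add, hx, hx']
        | tmul ω c => simp [rightMul_leftMul e hG hr hl, mul_assoc]
  induction a using (basis k φ).induction_span with
  | basis p =>
    obtain ⟨s, u⟩ := p
    induction ω using form_induction e with
    | zero => simp
    | add x y hx hy => simp only [map_add, hx, hy]
    | tmul a b =>
      -- Reduction to the invariant form e_b, on which both sides are explicit sums.
      have h1 : a ⊗ₜ e b = l a (1 ⊗ₜ[k] e b) := by rw [hl, mul_one]
      rw [h1, rightMul_leftMul e hG hr hl, rightCoaction_leftMul e hM hl,
        rightCoaction_leftMul e hM hl, hlr, hr, one_mul, rightCoaction_basis, rightCoaction_tmul]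
      congr 1
      simp only [Bialgebra.comul_one, one_mul, LinearMap.rTensor_tmul, LinearMap.flip_apply,
        TensorProduct.mk_apply, comul_basis, map_sum, LinearMap.sum_apply,
        TensorProduct.map₂_apply_tmul]
      rw [Finset.sum_comm]
      refine Finset.sum_congr rfl fun y _ => ?_
      have h := fun t => hr (s * y⁻¹, u) 1 (conjMem hM t b)
      -- The factor δ_t(δ_y ⊗ u) leaves only t = y, and then sy⁻¹ · yby⁻¹ = sby⁻¹.
      refine Eq.trans ?_ (Finset.sum_congr rfl fun t _ => congrArg₂ (· ⊗ₜ[k] ·) (h t).symm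
        ((basis_mul_basis k φ (t, 1) (y, u)).symm : _ = basis k φ (t, 1) * basis k φ (y, u)))
      simp [conjMem, ractMem, mul_ract, inv_ract, mul_assoc, tmul_ite]
  | zero => simp
  | add x y hx hy => simp only [map_add, LinearMap.add_apply, hx, hy]
  | smul c x hx => simp only [map_smul, LinearMap.smul_apply, hx]

end

end CrossProduct

/-! ### The inner differential and its bicovariance. -/

namespace CrossProduct

variable {k : Type*} [Field k] {G M : Type*} [Group G] [Group M] [Fintype M] {φ : G →* MulAut M}
  {C : Set M} [Fintype C] {V : Type*} [AddCommGroup V] [Module k V] (e : Module.Basis C k V)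
  {l r : CrossProduct k φ →ₗ[k] CrossProduct k φ ⊗[k] V →ₗ[k] CrossProduct k φ ⊗[k] V}
  {d : CrossProduct k φ →ₗ[k] CrossProduct k φ ⊗[k] V}

variable (φ) in
/-- The biinvariant form `∑_b e_b`, which generates the differential. -/
def theta : CrossProduct k φ ⊗[k] V := ∑ b : C, 1 ⊗ₜ e b

theorem leftCoaction_theta : leftCoaction φ (theta φ e) = 1 ⊗ₜ theta φ e := by
  simp [theta, leftCoaction_tmul, Algebra.TensorProduct.one_def, TensorProduct.tmul_sum]

theorem rightCoaction_theta (hM : ∀ a ∈ C, ∀ t : M, t * a * t⁻¹ ∈ C) :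
    rightCoaction φ e hM (theta φ e) = theta φ e ⊗ₜ 1 := by
  simp only [theta, map_sum, rightCoaction_tmul, Bialgebra.comul_one, one_mul,
    LinearMap.rTensor_tmul, LinearMap.flip_apply, TensorProduct.mk_apply]
  rw [Finset.sum_comm, one_def, TensorProduct.tmul_sum]
  refine Finset.sum_congr rfl fun t _ => ?_
  rw [TensorProduct.sum_tmul]
  -- Conjugation by t permutes C, so the sum of the e_b is unchanged.
  refine Fintype.sum_equiv ⟨conjMem hM t, conjMem hM t⁻¹, fun a => ?_, fun a => ?_⟩ _ _
    fun a => rfl <;> simp [conjMem, mul_assoc]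

/-- The two halves of the formula for d are θ(δ_s ⊗ u) and (δ_s ⊗ u)θ. Being inner reduces every
property of d to the bimodule laws and the invariance of θ. -/
theorem d_eq (hG : ∀ a ∈ C, ∀ u : G, ract φ a u ∈ C)
    (hl : ∀ a b v, l a (b ⊗ₜ v) = (a * b) ⊗ₜ v)
    (hr : ∀ p a b, r (basis k φ p) (a ⊗ₜ e b) =
      (a * basis k φ (p.1 * b, p.2)) ⊗ₜ e (ractMem hG b p.2))
    (hd : ∀ p, d (basis k φ p) = ∑ b : C,
      (basis k φ (p.1 * b, p.2) ⊗ₜ e (ractMem hG b p.2) - basis k φ p ⊗ₜ e b))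
    (a : CrossProduct k φ) : d a = r a (theta φ e) - l a (theta φ e) := by
  have : d = r.flip (theta φ e) - l.flip (theta φ e) := (basis k φ).ext fun p => by
    simp [hd, theta, hl, hr]
  rw [this]
  rfl

theorem isBicovariantCalculus (hC₁ : (1 : M) ∉ C) (hM : ∀ a ∈ C, ∀ t : M, t * a * t⁻¹ ∈ C)
    (hG : ∀ a ∈ C, ∀ u : G, ract φ a u ∈ C)
    (hl : ∀ a b v, l a (b ⊗ₜ v) = (a * b) ⊗ₜ v)
    (hr : ∀ p a b, r (basis k φ p) (a ⊗ₜ e b) =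
      (a * basis k φ (p.1 * b, p.2)) ⊗ₜ e (ractMem hG b p.2))
    (hd : ∀ p, d (basis k φ p) = ∑ b : C,
      (basis k φ (p.1 * b, p.2) ⊗ₜ e (ractMem hG b p.2) - basis k φ p ⊗ₜ e b)) :
    IsBicovariantCalculus l r d := by
  have hdθ := d_eq e hG hl hr hd
  have one_left : ∀ ω, l 1 ω = ω := fun ω => by
    induction ω using TensorProduct.induction_on with
    | zero => simp
    | add x y hx hy => simp only [map_add, hx, hy]
    | tmul a v => rw [hl, one_mul]
  have mul_left : ∀ a b ω, l (a * b) ω = l a (l b ω) := fun a b ω => by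
    induction ω using TensorProduct.induction_on with
    | zero => simp
    | add x y hx hy => simp only [map_add, hx, hy]
    | tmul a v => rw [hl, hl, hl, mul_assoc]
  refine { one_left, mul_left, one_right := rightMul_one e hG hr, mul_right := rightMul_mul e hG hr,
           left_right := rightMul_leftMul e hG hr hl, leibniz := fun a b => ?_, surjective := ?_,
           bicovariant := ⟨leftCoaction φ, rightCoaction φ e hM, leftCoaction_coassoc e,
            leftCoaction_counit e, rightCoaction_coassoc e hM, rightCoaction_counit e hM,
            leftCoaction_rightCoaction e hM, leftCoaction_leftMul hl,
            leftCoaction_rightMul e hG hr, rightCoaction_leftMul e hM hl,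
            rightCoaction_rightMul e hG hr hM hl, ?_, ?_⟩ }
  -- θab − abθ = a(θb − bθ) + (θa − aθ)b.
  · rw [hdθ, hdθ, hdθ, rightMul_mul e hG hr, mul_left, map_sub, map_sub,
      rightMul_leftMul e hG hr hl, sub_add_sub_cancel']
  · refine eq_top_iff.2 ((formBasis φ e).span_eq.ge.trans (Submodule.span_le.2 ?_))
    rintro _ ⟨⟨⟨s, u⟩, b⟩, rfl⟩
    -- Put t = (s ◁ u)b⁻¹. In (δ_s ⊗ u)dδ_t the product with δ_{tc} vanishes unless c = b, and the
    -- one with δ_t vanishes since b ≠ e; only (δ_s ⊗ u)e_b remains.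
    refine Submodule.subset_span ⟨basis k φ (s, u), basis k φ (ract φ s u * (b : M)⁻¹, 1), ?_⟩
    have hb : (b : M) ≠ 1 := fun h => hC₁ (h ▸ b.2)
    have h : ∀ c : C, ract φ s u = ract φ s u * (b : M)⁻¹ * c ↔ b = c := fun c => by
      rw [mul_assoc, left_eq_mul, inv_mul_eq_one, Subtype.ext_iff]
    simp [formBasis_apply, hd, hl, basis_mul_basis, h, hb, ractMem, ite_tmul]
  · ext a
    rw [LinearMap.comp_apply, LinearMap.comp_apply, hdθ, map_sub, leftCoaction_leftMul hl,
      leftCoaction_rightMul e hG hr, leftCoaction_theta]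
    induction CoalgebraStruct.comul (R := k) a using TensorProduct.induction_on with
    | zero => simp
    | add x y hx hy => simp only [map_add, LinearMap.add_apply, ← hx, ← hy]; abel
    | tmul x y => simp [hdθ, TensorProduct.tmul_sub]
  · ext a
    rw [LinearMap.comp_apply, LinearMap.comp_apply, hdθ, map_sub, rightCoaction_leftMul e hM hl,
      rightCoaction_rightMul e hG hr hM hl, rightCoaction_theta]
    induction CoalgebraStruct.comul (R := k) a using TensorProduct.induction_on with
    | zero => simp
    | add x y hx hy => simp only [map_add, LinearMap.add_apply, ← hx, ← hy]; abel
    | tmul x y => simp [hdθ, TensorProduct.sub_tmul]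

end CrossProduct

/-! ### The calculus on k(M). -/

namespace GroupCalculus

theorem isDifferentialCalculus (k : Type*) [Field k] {M : Type*} [Group M] [Finite M] (C : Set M)
    (hC₁ : (1 : M) ∉ C) : IsDifferentialCalculus (leftMul k C) (rightMul k C) (d k C) where
  one_left ω := by ext; simp [leftMul]
  mul_left a b ω := by ext; simp [leftMul, mul_assoc]
  one_right ω := by ext; simp [rightMul]
  mul_right a b ω := by ext; simp [rightMul, mul_assoc]
  left_right a b ω := by ext; simp [leftMul, rightMul, mul_assoc]
  leibniz a b := by ext; simp [leftMul, rightMul, d]; ring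
  surjective := by
    have := Fintype.ofFinite M
    refine eq_top_iff.2 fun ω _ => ?_
    -- Since a ≠ e, δ_s dδ_{sa} = δ_s e_a.
    have h : ω = ∑ a : C, ∑ s : M, ω a s • leftMul k C (Pi.single s 1)
        (d k C (Pi.single (s * (a : M)) 1)) := by
      ext a s
      have ha : ∀ a : C, (a : M) ≠ 1 := fun a h => hC₁ (h ▸ a.2)
      simp [leftMul, d, Pi.single_apply, Finset.sum_apply, Subtype.val_inj, ha]
    rw [h]
    exact Submodule.sum_mem _ fun a _ => Submodule.sum_mem _ fun s _ =>
      Submodule.smul_mem _ _ (Submodule.subset_span ⟨_, _, rfl⟩)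

end GroupCalculus

/-- A subspace of a span that is stable under the coordinate projections, and contains all of the
spanning vectors as soon as it contains one, is trivial. -/
theorem Submodule.eq_bot_or_eq_span_of_proj {ι k V : Type*} [Field k] [AddCommGroup V] [Module k V]
    {b : ι → V} {W : Submodule k V} (hW : W ≤ Submodule.span k (Set.range b))
    (P : ι → V →ₗ[k] V) (hP : ∀ i j, P i (b j) = if i = j then b j else 0)
    (hPW : ∀ i, ∀ w ∈ W, P i w ∈ W) (htrans : ∀ i j, b i ∈ W → b j ∈ W) :
    W = ⊥ ∨ W = Submodule.span k (Set.range b) := by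
  refine or_iff_not_imp_left.2 fun h => le_antisymm hW (Submodule.span_le.2 ?_)
  obtain ⟨w, hw, hw0⟩ := W.ne_bot_iff.1 h
  obtain ⟨c, rfl⟩ := Finsupp.mem_span_range_iff_exists_finsupp.1 (hW hw)
  obtain ⟨i, hi⟩ : ∃ i, c i ≠ 0 := by
    by_contra! h
    exact hw0 (by simp [Finsupp.sum, h])
  -- The projection isolates one non-zero coordinate and so puts b i itself in W.
  have hi' : P i (c.sum fun i a => a • b i) = c i • b i := by
    rw [Finsupp.sum, map_sum, Finset.sum_eq_single i]
    · simp [hP]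
    · intro j _ hj
      simp [hP, hj.symm]
    · intro h
      simp [Finsupp.notMem_support_iff.1 h]
  have hbi : b i ∈ W := (Submodule.smul_mem_iff W hi).1 (hi' ▸ hPW i _ hw)
  rintro _ ⟨j, rfl⟩
  exact htrans i j hbi

/-! ### The vectors f_a under the actions of X, of H and of functionals on H. -/

section CrossedModule

variable {k : Type*} [Field k] {G M : Type*} [Group G] [Group M] {φ : G →* MulAut M}

@[simp] theorem mFactor_inr_mul_inl (v : G) (t : M) :
    mFactor (inr v * inl t : M ⋊[φ] G) = t := by
  simp [mFactor, ract]

theorem xDegree_inr_mul_inl (v : G) (t : M) :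
    xDegree (inr v * inl t : M ⋊[φ] G) = inl (ract φ t⁻¹ v) := by
  simp [xDegree, inl_ract]

/-- This explains the shape of f_a: the inverse and the twist by v⁻¹ undo those in the degree, so
all summands have the same degree a. -/
theorem xDegree_tangent (v : G) (a : M) :
    xDegree (inr v * inl (ract φ a⁻¹ v⁻¹) : M ⋊[φ] G) = inl a := by
  rw [xDegree_inr_mul_inl, ← inv_ract, inv_inv, ract_ract, inv_mul_cancel, ract_one]

variable [Fintype G]

theorem kxProj_tangentVector (z : M ⋊[φ] G) (a : M) : kxProj k z (tangentVector k φ a) =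
    if inl a = z then tangentVector k φ a else 0 := by
  simp only [kxProj, tangentVector, map_sum, Finsupp.linearCombination_single, xDegree_tangent]
  split_ifs <;> simp

theorem tangentVector_mem_kxHomogeneous (a : M) :
    tangentVector k φ a ∈ kxHomogeneous k (inl a : M ⋊[φ] G) :=
  Submodule.sum_mem _ fun v _ => Finsupp.single_mem_supported k 1 (xDegree_tangent v a)

/-- With y = us, translation v ↦ vu permutes the summands while s conjugates their M-parts. Leaving
b free lets the lemma serve the centralizer, the representatives z̄ and D(X) alike. -/
theorem kxAct_tangentVector {y : M ⋊[φ] G} {a b : M} (h : y⁻¹ * inl a * y = inl b) :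
    kxAct k y (tangentVector k φ a) = tangentVector k φ b := by
  have hb : b = (mFactor y)⁻¹ * ract φ a y.right * mFactor y := by
    refine inl_injective (φ := φ) ?_
    rw [← h]
    conv_lhs => rw [← inr_mul_inl_mFactor y]
    simp [inl_ract, mul_assoc]
  simp only [kxAct, tangentVector, map_sum, Finsupp.lmapDomain_apply, Finsupp.mapDomain_single,
    xAct, mFactor_inr_mul_inl]
  refine Fintype.sum_equiv (Equiv.mulRight y.right) _ _ fun v => ?_
  simp only [SemidirectProduct.mul_right, right_inr, right_inl, mul_one, Equiv.coe_mulRight, hb, mul_inv_rev,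
    mul_ract, inv_ract, ract_ract, inv_inv, mul_assoc, mul_inv_cancel_left]

variable (k φ) in
theorem canonicalSubspace_eq_span (C : Set M) : canonicalSubspace k φ C =
    Submodule.span k (Set.range fun a : C => tangentVector k φ (a : M)) := by
  rw [canonicalSubspace, Submodule.span_range_eq_iSup, iSup_subtype']

theorem tangentVector_mem {C : Set M} {a : M} (ha : a ∈ C) :
    tangentVector k φ a ∈ canonicalSubspace k φ C := by
  rw [canonicalSubspace_eq_span]
  exact Submodule.subset_span ⟨⟨a, ha⟩, rfl⟩

theorem toH_tangentVector (a : M) : toH k φ (tangentVector k φ a) =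
    ∑ v : G, CrossCoproduct.basis k φ (ract φ a⁻¹ v⁻¹, v) := by
  simp [toH, tangentVector]

/-- Makes the unit of H one of the f_a, so that its behaviour under both actions is the case a = e
of the general formulas. -/
theorem toH_tangentVector_one : toH k φ (tangentVector k φ 1) = 1 := by
  simp [toH_tangentVector, CrossCoproduct.one_def]

theorem toHPlus_tangentVector (a : M) : toHPlus k φ (tangentVector k φ a) =
    toH k φ (tangentVector k φ a) - 1 := by
  have : CoalgebraStruct.counit (R := k) (toH k φ (tangentVector k φ a)) = 1 := by
    simp [toH_tangentVector, CrossCoproduct.counit_basis]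
  simp [toHPlus, this]

theorem CrossCoproduct.antipode_basis (p : M × G) :
    HopfAlgebraStruct.antipode k (CrossCoproduct.basis k φ p) =
      CrossCoproduct.basis k φ ((ract φ p.1 p.2)⁻¹, p.2⁻¹) :=
  Module.Basis.constr_basis ..

/-- For h = t ⊗ δ_v, the functions δ_{x⁻¹}, δ_y and δ_{x⁻¹v} multiply to zero unless x⁻¹ = y = x⁻¹v.
This forces v = e, and the M-parts are then conjugated by t ◁ x. -/
theorem adAction_toH_tangentVector (h : CrossCoproduct k φ) (a : M) [Fintype M] :
    adAction (k := k) h (toH k φ (tangentVector k φ a)) =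
      ∑ t : M, (CrossCoproduct.basis k φ).repr h (t, 1) •
        toH k φ (tangentVector k φ (t⁻¹ * a * t)) := by
  induction h using (CrossCoproduct.basis k φ).induction_span with
  | basis p =>
    obtain ⟨t, v⟩ := p
    simp only [adAction, CrossCoproduct.comul_basis, map_sum, LinearMap.sum_apply,
      TensorProduct.lift.tmul, LinearMap.compl₁₂_apply, LinearMap.comp_apply,
      LinearMap.mul_apply', Module.End.mul_apply, LinearMap.flip_apply,
      CrossCoproduct.antipode_basis, toH_tangentVector]
    have h : ∀ x y : G, CrossCoproduct.basis k φ ((ract φ t x)⁻¹, x⁻¹) *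
        (CrossCoproduct.basis k φ (ract φ a⁻¹ y⁻¹, y) *
          CrossCoproduct.basis k φ (ract φ t x, x⁻¹ * v)) =
        if x⁻¹ = y then (if v = 1 then
          CrossCoproduct.basis k φ (ract φ (t⁻¹ * a * t)⁻¹ y⁻¹, y) else 0) else 0 :=
      fun x y => by
        rw [CrossCoproduct.basis_mul_basis]
        by_cases hx : x⁻¹ = y
        · subst hx
          by_cases hv : v = 1 <;>
            simp [hv, CrossCoproduct.basis_mul_basis, mul_ract, inv_ract, mul_assoc]
        · split_ifs with h1
          · have h2 : y = x⁻¹ * v := h1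
            rw [CrossCoproduct.basis_mul_basis, if_neg (h2 ▸ hx)]
          · simp
    trans ∑ y : G, if v = 1 then
      CrossCoproduct.basis k φ (ract φ (t⁻¹ * a * t)⁻¹ y⁻¹, y) else 0
    · refine Finset.sum_congr rfl fun y _ => (Finset.sum_congr rfl fun x _ => h x y).trans ?_
      simp [inv_eq_iff_eq_inv]
    · by_cases hv : v = 1
      · simp [hv, Finsupp.single_apply, Prod.ext_iff]
      · simp [hv, Prod.ext_iff]
  | zero => simp [adAction]
  | add x y hx hy =>
    simp only [adAction, map_add, LinearMap.add_apply, Finsupp.add_apply, add_smul,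
      Finset.sum_add_distrib] at hx hy ⊢
    rw [hx, hy]
  | smul c x hx =>
    simp only [adAction, map_smul, LinearMap.smul_apply, Finsupp.smul_apply, smul_assoc,
      ← Finset.smul_sum] at hx ⊢
    rw [hx]

theorem coregAction_toH_tangentVector (f : Module.Dual k (CrossCoproduct k φ)) (a : M) :
    coregAction f (toH k φ (tangentVector k φ a)) =
      ∑ y : G, f (CrossCoproduct.basis k φ (ract φ a⁻¹ y⁻¹, y)) •
        toH k φ (tangentVector k φ (ract φ a y⁻¹)) := by
  simp only [toH_tangentVector, coregAction, LinearMap.comp_apply, map_sum,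
    CrossCoproduct.comul_basis, LinearMap.lTensor_tmul, LinearEquiv.coe_coe, rid_tmul,
    Finset.smul_sum]
  rw [Finset.sum_comm]
  conv_rhs => rw [Finset.sum_comm]
  refine Finset.sum_congr rfl fun x _ => ?_
  -- With y = x⁻¹u the right tensor factor depends on y alone, and the left one is a⁻¹ ◁ u⁻¹ = (a⁻¹
  -- ◁ y⁻¹) ◁ x⁻¹, a summand of f_{a◁y⁻¹}.
  refine Fintype.sum_equiv (Equiv.mulLeft x⁻¹) _ _ fun u => ?_
  simp [← inv_ract]

theorem adAction_toHPlus_tangentVector (h : CrossCoproduct k φ) (a : M) [Fintype M] :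
    adAction (k := k) h (toHPlus k φ (tangentVector k φ a)) =
      ∑ t : M, (CrossCoproduct.basis k φ).repr h (t, 1) •
        toHPlus k φ (tangentVector k φ (t⁻¹ * a * t)) := by
  simp only [toHPlus_tangentVector, ← toH_tangentVector_one, map_sub, smul_sub,
    adAction_toH_tangentVector]
  simp [Finset.sum_sub_distrib]

/-- The terms f(1)1 cancel, and what is left to subtract is f(f_a)1. As f(f_a) is the sum of the
coefficients, it supplies the −1 in each Π(f_{a◁y⁻¹}). -/
theorem coregActionPlus_toHPlus_tangentVector (f : Module.Dual k (CrossCoproduct k φ)) (a : M) :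
    coregActionPlus f (toHPlus k φ (tangentVector k φ a)) =
      ∑ y : G, f (CrossCoproduct.basis k φ (ract φ a⁻¹ y⁻¹, y)) •
        toHPlus k φ (tangentVector k φ (ract φ a y⁻¹)) := by
  have h1 : coregAction f (1 : CrossCoproduct k φ) = f 1 • 1 := by
    rw [← toH_tangentVector_one, coregAction_toH_tangentVector]
    simp only [toH_tangentVector, inv_one, one_ract, map_sum, Finset.sum_smul]
  simp only [toHPlus_tangentVector, coregActionPlus, LinearMap.sub_apply, map_sub, h1, smul_sub,
    coregAction_toH_tangentVector, LinearMap.smulRight_apply, Finset.sum_sub_distrib,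
    ← Finset.sum_smul, ← map_sum, ← toH_tangentVector]
  abel

/-- The coordinates of the vectors `Π(f_a)`. -/
theorem repr_toHPlus_tangentVector (a : M) (p : M × G) :
    (CrossCoproduct.basis k φ).repr (toHPlus k φ (tangentVector k φ a)) p =
      (if p.1 = ract φ a⁻¹ p.2⁻¹ then 1 else 0) - if p.1 = 1 then 1 else 0 := by
  obtain ⟨s, u⟩ := p
  have h : ∀ (v : G) (x : M), (x, v) = (s, u) ↔ v = u ∧ s = x := by
    simp [Prod.ext_iff, and_comm, eq_comm]
  simp only [toHPlus_tangentVector, toH_tangentVector, CrossCoproduct.one_def, map_sub, map_sum,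
    Module.Basis.repr_self, Finsupp.sub_apply, Finsupp.finsetSum_apply, Finsupp.single_apply, h,
    ite_and, Finset.sum_ite_eq', Finset.mem_univ, if_true]

end CrossedModule

/-! ### Irreducibility of 𝓜 and of the quantum tangent space Π(𝓜). -/

section CanonicalTangentSpace

variable {k : Type*} [Field k] {G M : Type*} [Group G] [Group M] {φ : G →* MulAut M} {C : Set M}

theorem conj_mem_of_eq_conjugatesOf (hC : ∃ t : M, C = conjugatesOf t) (a : M) (ha : a ∈ C)
    (t : M) : t * a * t⁻¹ ∈ C := by
  obtain ⟨x, rfl⟩ := hC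
  exact IsConj.trans ha (isConj_iff.2 ⟨t, rfl⟩)

theorem exists_conj_of_eq_conjugatesOf (hC : ∃ t : M, C = conjugatesOf t) {a b : M} (ha : a ∈ C)
    (hb : b ∈ C) : ∃ t : M, t⁻¹ * a * t = b := by
  obtain ⟨x, rfl⟩ := hC
  obtain ⟨t, ht⟩ := isConj_iff.1 (IsConj.trans (IsConj.symm ha) hb)
  exact ⟨t⁻¹, by rwa [inv_inv]⟩

theorem inl_image_eq_conjugatesOf (hC : ∃ t : M, C = conjugatesOf t)
    (hG : ∀ a ∈ C, ∀ u : G, ract φ a u ∈ C) {a : M} (ha : a ∈ C) :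
    inl '' C = conjugatesOf (inl a : M ⋊[φ] G) := by
  ext x
  constructor
  · rintro ⟨b, hb, rfl⟩
    obtain ⟨t, ht⟩ := exists_conj_of_eq_conjugatesOf hC ha hb
    exact isConj_iff.2 ⟨inl t⁻¹, by simp [← ht]⟩
  · intro h
    obtain ⟨y, rfl⟩ := isConj_iff.1 h
    -- Conjugation by y is conjugation by its G-part, which preserves C by invariance, followed by
    -- conjugation by its M-part.
    refine ⟨_, conj_mem_of_eq_conjugatesOf hC _ (hG a ha y.right⁻¹) y.left, ?_⟩
    conv_rhs => rw [← inl_left_mul_inr_right y]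
    simp [inl_ract, mul_assoc, -inl_left_mul_inr_right]

variable [Fintype G]

/-- The coordinates at a⁻¹ ⊗ δ_e form a dual family: subtracting 1 affects only the coordinates at e
⊗ δ_v, and a ≠ e. -/
theorem linearIndependent_toHPlus_tangentVector (hC₁ : (1 : M) ∉ C) :
    LinearIndependent k (fun a : C => toHPlus k φ (tangentVector k φ (a : M))) := by
  refine LinearIndependent.of_pairwise_dual_eq_zero_one _
    (fun a : C => (CrossCoproduct.basis k φ).coord ((a : M)⁻¹, 1)) ?_ ?_
  · intro a b hab
    have ha : (a : M) ≠ 1 := fun h => hC₁ (h ▸ a.2)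
    simpa [repr_toHPlus_tangentVector, ha, Subtype.val_inj] using hab
  · intro a
    have ha : (a : M) ≠ 1 := fun h => hC₁ (h ▸ a.2)
    simp [repr_toHPlus_tangentVector, ha]

theorem toHPlus_tangentVector_ne_zero {a : M} (ha : a ≠ 1) :
    toHPlus k φ (tangentVector k φ a) ≠ 0 := fun h => by
  have := repr_toHPlus_tangentVector (k := k) (φ := φ) a (a⁻¹, 1)
  simp [h, ha] at this

theorem tangentVector_ne_zero {a : M} (ha : a ≠ 1) : tangentVector k φ a ≠ 0 := fun h =>
  toHPlus_tangentVector_ne_zero (k := k) (φ := φ) ha (by rw [h, map_zero])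

theorem linearIndependent_tangentVector (hC₁ : (1 : M) ∉ C) :
    LinearIndependent k (fun a : C => tangentVector k φ (a : M)) :=
  LinearIndependent.of_comp (toHPlus k φ) (linearIndependent_toHPlus_tangentVector hC₁)

theorem injOn_toHPlus (hC₁ : (1 : M) ∉ C) :
    Set.InjOn (toHPlus k φ) (canonicalSubspace k φ C) := by
  refine LinearMap.injOn_of_disjoint_ker subset_rfl ?_
  rw [canonicalSubspace_eq_span]
  exact Submodule.range_ker_disjoint (linearIndependent_toHPlus_tangentVector hC₁)

variable (k φ) in
theorem map_toHPlus_canonicalSubspace (C : Set M) :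
    (canonicalSubspace k φ C).map (toHPlus k φ) =
      Submodule.span k (Set.range fun a : C => toHPlus k φ (tangentVector k φ (a : M))) := by
  rw [canonicalSubspace_eq_span, Submodule.map_span, ← Set.range_comp]
  rfl

/-- Used for 𝓜₀, on which the centralizer of z₀ acts trivially since it fixes f_{z₀}. -/
theorem isIrreducibleUnder_span_singleton {k V : Type*} [Field k] [AddCommGroup V] [Module k V]
    {S : Set (V →ₗ[k] V)} {v : V} (hv : v ≠ 0) (hS : ∀ T ∈ S, T v = v) :
    IsIrreducibleUnder S (Submodule.span k {v}) where
  ne_bot := by simpa using hv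
  stable T hT w hw := by
    obtain ⟨c, rfl⟩ := Submodule.mem_span_singleton.1 hw
    rwa [map_smul, hS T hT]
  minimal W hW _ := by
    have := (nonzero_span_atom v hv).le_iff.1 hW
    exact this

theorem isIrreducibleUnder_doubleOperators (hC : ∃ t : M, C = conjugatesOf t) (hC₁ : (1 : M) ∉ C)
    (hG : ∀ a ∈ C, ∀ u : G, ract φ a u ∈ C) :
    IsIrreducibleUnder (doubleOperators k φ) (canonicalSubspace k φ C) where
  ne_bot := by
    obtain ⟨t, ht⟩ := hC
    have ht : t ∈ C := ht ▸ mem_conjugatesOf_self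
    exact (Submodule.ne_bot_iff _).2 ⟨_, tangentVector_mem ht,
      tangentVector_ne_zero (ne_of_mem_of_not_mem ht hC₁)⟩
  stable := by
    rintro _ ⟨⟨z, y⟩, rfl⟩ w hw
    rw [canonicalSubspace_eq_span] at hw
    induction hw using Submodule.span_induction with
    | mem x hx =>
      obtain ⟨a, rfl⟩ := hx
      simp only [LinearMap.comp_apply, kxProj_tangentVector]
      split_ifs
      · obtain ⟨b, hb, h⟩ : y⁻¹ * inl (a : M) * y ∈ inl '' C := by
          rw [inl_image_eq_conjugatesOf hC hG a.2]
          exact isConj_iff.2 ⟨y⁻¹, by simp⟩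
        rw [kxAct_tangentVector h.symm]
        exact tangentVector_mem hb
      · simp
    | zero => simp
    | add x y _ _ hx hy => rw [map_add]; exact add_mem hx hy
    | smul c x _ hx => rw [map_smul]; exact Submodule.smul_mem _ c hx
  minimal W hW hS := by
    have hSm : ∀ z y, ∀ w ∈ W, kxAct k y (kxProj k z w) ∈ W := fun z y w hw =>
      hS _ ⟨(z, y), rfl⟩ w hw
    rw [canonicalSubspace_eq_span] at hW ⊢
    refine Submodule.eq_bot_or_eq_span_of_proj (b := fun a : C => tangentVector k φ (a : M)) hW
      -- The action of 1 ∈ X fixes every f_a; it is included only to make the degree projection one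
      -- of the operators of D(X).
      (fun a => kxAct k 1 ∘ₗ kxProj k (inl (a : M))) (fun a b => ?_)
      (fun a w hw => hSm _ _ w hw) (fun a b ha => ?_)
    · simp only [LinearMap.comp_apply, kxProj_tangentVector, inl_inj, Subtype.val_inj,
        @eq_comm _ b a]
      split_ifs
      · exact kxAct_tangentVector (by simp)
      · simp
    · obtain ⟨t, ht⟩ := exists_conj_of_eq_conjugatesOf hC a.2 b.2
      have := hSm (inl a) (inl t) _ ha
      rwa [kxProj_tangentVector, if_pos rfl, kxAct_tangentVector (b := (b : M)) (by simp [← ht])] at this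

/-- A single m' realizes both operators: this gives at once the stability of 𝓜 inside H and the
equivariance of Π. By linearity it suffices to treat the f_a. -/
theorem exists_mem_canonicalSubspace {X Y : CrossCoproduct k φ →ₗ[k] CrossCoproduct k φ}
    (h : ∀ a ∈ C, ∃ m ∈ canonicalSubspace k φ C,
      toH k φ m = X (toH k φ (tangentVector k φ a)) ∧
      toHPlus k φ m = Y (toHPlus k φ (tangentVector k φ a))) :
    ∀ m ∈ canonicalSubspace k φ C, ∃ m' ∈ canonicalSubspace k φ C,
      toH k φ m' = X (toH k φ m) ∧ toHPlus k φ m' = Y (toHPlus k φ m) := by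
  intro m hm
  conv at hm => rw [canonicalSubspace_eq_span]
  induction hm using Submodule.span_induction with
  | mem x hx =>
    obtain ⟨a, rfl⟩ := hx
    exact h a a.2
  | zero => exact ⟨0, zero_mem _, by simp, by simp⟩
  | add x y _ _ hx hy =>
    obtain ⟨x', hx', h1, h2⟩ := hx
    obtain ⟨y', hy', h3, h4⟩ := hy
    exact ⟨x' + y', add_mem hx' hy', by simp [h1, h3], by simp [h2, h4]⟩
  | smul c x _ hx =>
    obtain ⟨x', hx', h1, h2⟩ := hx
    exact ⟨c • x', Submodule.smul_mem _ c hx', by simp [h1], by simp [h2]⟩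

theorem exists_adAction [Fintype M] (hC : ∃ t : M, C = conjugatesOf t) (h : CrossCoproduct k φ) :
    ∀ m ∈ canonicalSubspace k φ C, ∃ m' ∈ canonicalSubspace k φ C,
      toH k φ m' = adAction (k := k) h (toH k φ m) ∧
      toHPlus k φ m' = adAction (k := k) h (toHPlus k φ m) :=
  exists_mem_canonicalSubspace fun a ha =>
    ⟨∑ t : M, (CrossCoproduct.basis k φ).repr h (t, 1) • tangentVector k φ (t⁻¹ * a * t),
      Submodule.sum_mem _ fun t _ => Submodule.smul_mem _ _ (tangentVector_mem (by
        simpa using conj_mem_of_eq_conjugatesOf hC a ha t⁻¹)),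
      by rw [adAction_toH_tangentVector]; simp, by rw [adAction_toHPlus_tangentVector]; simp⟩

theorem exists_coregAction (hG : ∀ a ∈ C, ∀ u : G, ract φ a u ∈ C)
    (f : Module.Dual k (CrossCoproduct k φ)) :
    ∀ m ∈ canonicalSubspace k φ C, ∃ m' ∈ canonicalSubspace k φ C,
      toH k φ m' = coregAction f (toH k φ m) ∧
      toHPlus k φ m' = coregActionPlus f (toHPlus k φ m) :=
  exists_mem_canonicalSubspace fun a ha =>
    ⟨∑ y : G, f (CrossCoproduct.basis k φ (ract φ a⁻¹ y⁻¹, y)) •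
        tangentVector k φ (ract φ a y⁻¹),
      Submodule.sum_mem _ fun t _ => Submodule.smul_mem _ _ (tangentVector_mem (hG a ha _)),
      by rw [coregAction_toH_tangentVector]; simp,
      by rw [coregActionPlus_toHPlus_tangentVector]; simp⟩

variable (k) in
/-- The canonical quantum tangent space `Π(𝓜)`. -/
def canonicalTangentSpace [Fintype M] (hC : ∃ t : M, C = conjugatesOf t)
    (hG : ∀ a ∈ C, ∀ u : G, ract φ a u ∈ C) : QuantumTangentSpace k (CrossCoproduct k φ) where
  toSubmodule := (canonicalSubspace k φ C).map (toHPlus k φ)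
  counit_eq_zero := by
    rintro _ ⟨m, _, rfl⟩
    simp [toHPlus]
  adAction_mem := by
    rintro g _ ⟨m, hm, rfl⟩
    obtain ⟨m', hm', -, h⟩ := exists_adAction hC g m hm
    exact ⟨m', hm', h⟩
  coregActionPlus_mem := by
    rintro f _ ⟨m, hm, rfl⟩
    obtain ⟨m', hm', -, h⟩ := exists_coregAction hG f m hm
    exact ⟨m', hm', h⟩

theorem isIrreducible_canonicalTangentSpace [Fintype M] (hC : ∃ t : M, C = conjugatesOf t)
    (hC₁ : (1 : M) ∉ C) (hG : ∀ a ∈ C, ∀ u : G, ract φ a u ∈ C) :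
    (canonicalTangentSpace k hC hG).IsIrreducible := by
  have hspan : (canonicalTangentSpace k hC hG).toSubmodule = _ :=
    map_toHPlus_canonicalSubspace k φ C
  refine ⟨?_, fun L' hL' => ?_⟩
  · obtain ⟨t, ht⟩ := id hC
    have ht : t ∈ C := ht ▸ mem_conjugatesOf_self
    exact (Submodule.ne_bot_iff _).2 ⟨_, ⟨_, tangentVector_mem ht, rfl⟩,
      toHPlus_tangentVector_ne_zero (ne_of_mem_of_not_mem ht hC₁)⟩
  · rw [hspan] at hL' ⊢
    refine Submodule.eq_bot_or_eq_span_of_proj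
      (b := fun a : C => toHPlus k φ (tangentVector k φ (a : M))) hL'
      -- Only y = e contributes for the coordinate functional at a⁻¹ ⊗ δ_e, so it acts as the
      -- projection to Π(f_a).
      (fun a => coregActionPlus ((CrossCoproduct.basis k φ).coord ((a : M)⁻¹, 1)))
      (fun a b => ?_) (fun a w hw => L'.coregActionPlus_mem _ w hw) (fun a b ha => ?_)
    · rw [coregActionPlus_toHPlus_tangentVector, Finset.sum_eq_single 1]
      · simp [Finsupp.single_apply, Subtype.ext_iff, @eq_comm _ (b : M)]
      · intro y _ hy
        simp [Prod.ext_iff, hy]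
      · simp
    · obtain ⟨t, ht⟩ := exists_conj_of_eq_conjugatesOf hC a.2 b.2
      -- The adjoint action of t ⊗ δ_e is conjugation by t, which carries a to b.
      have := L'.adAction_mem (CrossCoproduct.basis k φ (t, 1)) _ ha
      rw [adAction_toHPlus_tangentVector, Finset.sum_eq_single t] at this
      · simpa [ht] using this
      · intro y _ hy
        simp [Prod.ext_iff, hy.symm]
      · simp

end CanonicalTangentSpace

/-! ### The bimodule relations and differential of the canonical calculus. -/

section CanonicalCalculus

open CrossProduct (ractMem)

variable {k : Type*} [Field k] {G M : Type*} [Group G] [Group M] {φ : G →* MulAut M} {C : Set M}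

theorem pairing_basis (p : M × G) (h : CrossCoproduct k φ) :
    pairing k φ (CrossProduct.basis k φ p) h = (CrossCoproduct.basis k φ).repr h p := by
  have : pairing k φ (CrossProduct.basis k φ p) = (CrossCoproduct.basis k φ).coord p :=
    (CrossCoproduct.basis k φ).ext fun q => by
      simp [pairing, Module.Basis.constr_basis, Finsupp.single_apply, @eq_comm _ p]
  rw [this]
  rfl

theorem CrossProduct.ofFun_apply [Fintype M] (f : M → k) :
    CrossProduct.ofFun φ f = ∑ s : M, f s • CrossProduct.basis k φ (s, 1) := rfl

@[simp] theorem CrossProduct.ofFun_single [Fintype M] (s : M) :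
    CrossProduct.ofFun φ (Pi.single s (1 : k)) = CrossProduct.basis k φ (s, 1) := by
  simp [CrossProduct.ofFun_apply, Pi.single_apply]

variable [Fintype G] [Fintype M] (hC : ∃ t : M, C = conjugatesOf t) (hC₁ : (1 : M) ∉ C)
  (hG : ∀ a ∈ C, ∀ u : G, ract φ a u ∈ C)

variable (k) in
/-- The basis `Π(f_a)` of the canonical quantum tangent space. -/
def canonicalTangentBasis : Module.Basis C k (canonicalTangentSpace k hC hG).toSubmodule :=
  (Module.Basis.span (linearIndependent_toHPlus_tangentVector (k := k) (φ := φ) hC₁)).map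
    (LinearEquiv.ofEq _ _ (map_toHPlus_canonicalSubspace k φ C).symm)

theorem canonicalTangentBasis_apply (a : C) :
    (canonicalTangentBasis k hC hC₁ hG a : CrossCoproduct k φ) =
      toHPlus k φ (tangentVector k φ (a : M)) := by
  rw [canonicalTangentBasis, Module.Basis.map_apply]
  exact congrArg Subtype.val (Module.Basis.span_apply
    (linearIndependent_toHPlus_tangentVector (k := k) (φ := φ) hC₁) a)

variable (k) in
/-- The basis of invariant 1-forms dual to the vectors `Π(f_a)`. -/
def canonicalForms : Module.Basis C k (canonicalTangentSpace k hC hG).InvForms :=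
  (canonicalTangentBasis k hC hC₁ hG).dualBasis

theorem canonicalForms_apply (a b : C) :
    canonicalForms k hC hC₁ hG a (canonicalTangentBasis k hC hC₁ hG b) =
      if b = a then 1 else 0 := by
  rw [canonicalForms, Module.Basis.dualBasis_apply_self]

theorem act_canonicalTangentBasis (f : Module.Dual k (CrossCoproduct k φ)) (a : C) :
    (canonicalTangentSpace k hC hG).act f (canonicalTangentBasis k hC hC₁ hG a) =
      ∑ y : G, f (CrossCoproduct.basis k φ (ract φ (a : M)⁻¹ y⁻¹, y)) •
        canonicalTangentBasis k hC hC₁ hG (ractMem hG a y⁻¹) := by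
  refine Subtype.ext ?_
  rw [QuantumTangentSpace.act, LinearMap.coe_restrict_apply, canonicalTangentBasis_apply,
    coregActionPlus_toHPlus_tangentVector]
  simp [canonicalTangentBasis_apply, ractMem]

/-- On Π(f_c), the functional δ_s ⊗ u sees only y = u, requires s = c⁻¹ ◁ u⁻¹ and produces
Π(f_{c◁u⁻¹}). Pairing with e_b forces c = b ◁ u, hence s = b⁻¹. -/
theorem formAction_canonicalForms (s : M) (u : G) (b : C) :
    (canonicalTangentSpace k hC hG).formAction (pairing k φ) (CrossProduct.basis k φ (s, u))
      (canonicalForms k hC hC₁ hG b) =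
      if s = (b : M)⁻¹ then canonicalForms k hC hC₁ hG (ractMem hG b u) else 0 := by
  refine (canonicalTangentBasis k hC hC₁ hG).ext fun c => ?_
  trans canonicalForms k hC hC₁ hG b ((canonicalTangentSpace k hC hG).act
    (pairing k φ (CrossProduct.basis k φ (s, u))) (canonicalTangentBasis k hC hC₁ hG c))
  · rfl
  rw [act_canonicalTangentBasis, map_sum, Finset.sum_eq_single u]
  · have h : ractMem hG c u⁻¹ = b ↔ c = ractMem hG b u := by
      simp only [ractMem, Subtype.ext_iff]
      rw [← ract_inj φ (u := u), ract_ract, inv_mul_cancel, ract_one]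
    simp only [map_smul, pairing_basis, canonicalForms_apply, h, Module.Basis.repr_self,
      Finsupp.single_apply, smul_eq_mul, Prod.mk.injEq, and_true]
    by_cases hc : c = ractMem hG b u
    · subst hc
      split_ifs <;> simp_all [ractMem, ← inv_ract, canonicalForms_apply]
    · split_ifs <;> simp [hc, canonicalForms_apply]
  · intro y _ hy
    simp [pairing_basis, hy]
  · simp

/-- Of the terms (δ_{sy⁻¹} ⊗ u) ⊗ (e_b ◁ (δ_y ⊗ u)) only y = b⁻¹ survives. -/
theorem rightMul_canonicalForms (p : M × G) (a : CrossProduct k φ) (b : C) :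
    (canonicalTangentSpace k hC hG).rightMul (pairing k φ) (CrossProduct.basis k φ p)
      (a ⊗ₜ canonicalForms k hC hC₁ hG b) =
      (a * CrossProduct.basis k φ (p.1 * b, p.2)) ⊗ₜ
        canonicalForms k hC hC₁ hG (ractMem hG b p.2) := by
  obtain ⟨s, u⟩ := p
  rw [QuantumTangentSpace.rightMul, LinearMap.comp_apply, CrossProduct.comul_basis, map_sum,
    LinearMap.sum_apply]
  trans ∑ y : M, (a * CrossProduct.basis k φ (s * y⁻¹, u)) ⊗ₜ[k]
    (canonicalTangentSpace k hC hG).formAction (pairing k φ) (CrossProduct.basis k φ (y, u))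
      (canonicalForms k hC hC₁ hG b)
  · rfl
  simp only [formAction_canonicalForms, tmul_ite]
  simp

theorem proj_canonicalTangentSpace (y : M) (u : G) :
    (canonicalTangentSpace k hC hG).proj (pairing k φ) (CrossProduct.basis k φ (y, u)) =
      ∑ c : C, ((if y = ract φ (c : M)⁻¹ u⁻¹ then (1 : k) else 0) - if y = 1 then 1 else 0) •
        canonicalForms k hC hC₁ hG c := by
  refine (canonicalTangentBasis k hC hC₁ hG).ext fun c => ?_
  -- The unit of A pairs to zero with Π(f_c), so subtracting ε(a)1 in `proj` changes nothing.
  have h1 : pairing k φ 1 (toHPlus k φ (tangentVector k φ (c : M))) = 0 := by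
    simp only [CrossProduct.one_def, map_sum, LinearMap.sum_apply, pairing_basis,
      repr_toHPlus_tangentVector, Finset.sum_sub_distrib]
    simp
  have h2 : (canonicalTangentSpace k hC hG).proj (pairing k φ) (CrossProduct.basis k φ (y, u))
      (canonicalTangentBasis k hC hC₁ hG c) = pairing k φ (CrossProduct.basis k φ (y, u))
        (toHPlus k φ (tangentVector k φ (c : M))) := by
    rw [← canonicalTangentBasis_apply hC hC₁ hG] at h1 ⊢
    simp [QuantumTangentSpace.proj, Algebra.algebraMap_eq_smul_one, h1]
  rw [h2, pairing_basis, repr_toHPlus_tangentVector]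
  simp [LinearMap.sum_apply, canonicalForms_apply]

theorem d_canonicalTangentSpace (p : M × G) :
    (canonicalTangentSpace k hC hG).d (pairing k φ) (CrossProduct.basis k φ p) = ∑ b : C,
      (CrossProduct.basis k φ (p.1 * b, p.2) ⊗ₜ canonicalForms k hC hC₁ hG (ractMem hG b p.2) -
        CrossProduct.basis k φ p ⊗ₜ canonicalForms k hC hC₁ hG b) := by
  obtain ⟨s, u⟩ := p
  have h : ∀ c : C, ∑ y : M, ((if y = ract φ (c : M)⁻¹ u⁻¹ then (1 : k) else 0) -
      if y = 1 then 1 else 0) • CrossProduct.basis k φ (s * y⁻¹, u) =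
      CrossProduct.basis k φ (s * ract φ c u⁻¹, u) - CrossProduct.basis k φ (s, u) := fun c => by
    simp [sub_smul, inv_ract]
  trans ∑ c : C, (∑ y : M, ((if y = ract φ (c : M)⁻¹ u⁻¹ then (1 : k) else 0) -
      if y = 1 then 1 else 0) • CrossProduct.basis k φ (s * y⁻¹, u)) ⊗ₜ[k]
        canonicalForms k hC hC₁ hG c
  · rw [QuantumTangentSpace.d, LinearMap.comp_apply, CrossProduct.comul_basis, map_sum]
    simp only [LinearMap.lTensor_tmul, proj_canonicalTangentSpace hC hC₁ hG,
      TensorProduct.tmul_sum, TensorProduct.tmul_smul, TensorProduct.sum_tmul,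
      ← TensorProduct.smul_tmul']
    exact Finset.sum_comm
  · simp only [h, TensorProduct.sub_tmul, Finset.sum_sub_distrib]
    congr 1
    -- The sum is reindexed by c = b ◁ u, so that s(c ◁ u⁻¹) becomes sb.
    refine Fintype.sum_equiv ⟨fun a => ractMem hG a u⁻¹, fun a => ractMem hG a u, fun a => ?_,
      fun a => ?_⟩ _ _ fun a => ?_ <;> simp [ractMem]

include hC₁ in
theorem isBicovariantCalculus_canonicalTangentSpace :
    IsBicovariantCalculus (A := CrossProduct k φ) (canonicalTangentSpace k hC hG).leftMul
      ((canonicalTangentSpace k hC hG).rightMul (pairing k φ))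
      ((canonicalTangentSpace k hC hG).d (pairing k φ)) :=
  CrossProduct.isBicovariantCalculus (canonicalForms k hC hC₁ hG) hC₁
    (conj_mem_of_eq_conjugatesOf hC) hG (fun _ _ _ => rfl) (rightMul_canonicalForms hC hC₁ hG)
    (d_canonicalTangentSpace hC hC₁ hG)

end CanonicalCalculus

/-! ### Restriction of the calculus to k(M). -/

section Restriction

variable {k : Type*} [Field k] {G M : Type*} [Group G] [Group M] [Fintype M] {φ : G →* MulAut M}
  {C : Set M} {V : Type*} [AddCommGroup V] [Module k V] (e : Module.Basis C k V)

variable (φ) in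
/-- The inclusion of the 1-forms on `k(M)` defined by `C⁻¹` into the 1-forms on `k(M) ⋊ kG`, with
`e_{a⁻¹}` identified with `e_a`. -/
def restrictionMap : ((C⁻¹ : Set M) → M → k) →ₗ[k] CrossProduct k φ ⊗[k] V :=
  ∑ a : C, ((TensorProduct.mk k (CrossProduct k φ) V).flip (e a)) ∘ₗ
    (CrossProduct.ofFun φ).toLinearMap ∘ₗ
      LinearMap.proj (⟨(a : M)⁻¹, Set.inv_mem_inv.2 a.2⟩ : (C⁻¹ : Set M))

theorem restrictionMap_apply (ω : (C⁻¹ : Set M) → M → k) : restrictionMap φ e ω =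
    ∑ a : C, CrossProduct.ofFun φ (ω ⟨(a : M)⁻¹, Set.inv_mem_inv.2 a.2⟩) ⊗ₜ e a := by
  simp [restrictionMap, LinearMap.sum_apply]

theorem restrictionMap_injective : Function.Injective (restrictionMap (k := k) φ e) := by
  refine (injective_iff_map_eq_zero _).2 fun ω hω => ?_
  ext ⟨b, hb⟩ s
  have h := congrArg (fun η => (CrossProduct.formBasis φ e).repr η ((s, 1), ⟨b⁻¹, hb⟩)) hω
  simp only [restrictionMap_apply, CrossProduct.ofFun_apply, TensorProduct.sum_tmul,
    ← TensorProduct.smul_tmul', ← CrossProduct.formBasis_apply, map_sum, map_smul,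
    Module.Basis.repr_self, Finsupp.finsetSum_apply, Finsupp.smul_apply, Finsupp.single_apply,
    Prod.mk.injEq, and_true, map_zero, Finsupp.zero_apply, smul_eq_mul, mul_ite, mul_one,
    mul_zero, ite_and] at h
  simpa [Finset.sum_ite_eq] using h

theorem restrictionMap_single (a : C) (f : M → k) :
    restrictionMap φ e (Pi.single ⟨(a : M)⁻¹, Set.inv_mem_inv.2 a.2⟩ f) =
      CrossProduct.ofFun φ f ⊗ₜ e a := by
  rw [restrictionMap_apply, Finset.sum_eq_single a]
  · simp
  · intro b _ hb
    rw [Pi.single_eq_of_ne, map_zero, TensorProduct.zero_tmul]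
    simpa [Subtype.ext_iff] using hb
  · simp

theorem restrictionMap_leftMul {l : CrossProduct k φ →ₗ[k] CrossProduct k φ ⊗[k] V →ₗ[k]
      CrossProduct k φ ⊗[k] V}
    (hl : ∀ a b v, l a (b ⊗ₜ v) = (a * b) ⊗ₜ v) (f : M → k) (ω : (C⁻¹ : Set M) → M → k) :
    restrictionMap φ e (GroupCalculus.leftMul k C⁻¹ f ω) =
      l (CrossProduct.ofFun φ f) (restrictionMap φ e ω) := by
  simp only [restrictionMap_apply, map_sum, hl, ← map_mul]
  rfl

/-- Summing e_bδ_s = δ_{sb}e_b against f(s) gives the function x ↦ f(xb⁻¹): translation by b⁻¹, the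
source of C⁻¹. -/
theorem rightMul_ofFun {hG : ∀ a ∈ C, ∀ u : G, ract φ a u ∈ C}
    {r : CrossProduct k φ →ₗ[k] CrossProduct k φ ⊗[k] V →ₗ[k] CrossProduct k φ ⊗[k] V}
    (hr : ∀ p a b, r (CrossProduct.basis k φ p) (a ⊗ₜ e b) =
      (a * CrossProduct.basis k φ (p.1 * b, p.2)) ⊗ₜ e (CrossProduct.ractMem hG b p.2))
    (f : M → k) (a : CrossProduct k φ) (b : C) :
    r (CrossProduct.ofFun φ f) (a ⊗ₜ e b) =
      (a * CrossProduct.ofFun φ fun x => f (x * (b : M)⁻¹)) ⊗ₜ e b := by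
  simp only [CrossProduct.ofFun_apply, map_sum, map_smul, LinearMap.sum_apply,
    LinearMap.smul_apply, hr, Finset.mul_sum, TensorProduct.sum_tmul, mul_smul_comm,
    ← TensorProduct.smul_tmul']
  exact Fintype.sum_equiv (Equiv.mulRight (b : M)) _ _ fun s => by simp [CrossProduct.ractMem]

theorem restrictionMap_rightMul {hG : ∀ a ∈ C, ∀ u : G, ract φ a u ∈ C}
    {r : CrossProduct k φ →ₗ[k] CrossProduct k φ ⊗[k] V →ₗ[k] CrossProduct k φ ⊗[k] V}
    (hr : ∀ p a b, r (CrossProduct.basis k φ p) (a ⊗ₜ e b) =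
      (a * CrossProduct.basis k φ (p.1 * b, p.2)) ⊗ₜ e (CrossProduct.ractMem hG b p.2))
    (f : M → k) (ω : (C⁻¹ : Set M) → M → k) :
    restrictionMap φ e (GroupCalculus.rightMul k C⁻¹ f ω) =
      r (CrossProduct.ofFun φ f) (restrictionMap φ e ω) := by
  simp only [restrictionMap_apply, map_sum, rightMul_ofFun e hr, ← map_mul]
  rfl

theorem restrictionMap_d {hG : ∀ a ∈ C, ∀ u : G, ract φ a u ∈ C}
    {l r : CrossProduct k φ →ₗ[k] CrossProduct k φ ⊗[k] V →ₗ[k] CrossProduct k φ ⊗[k] V}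
    {d : CrossProduct k φ →ₗ[k] CrossProduct k φ ⊗[k] V}
    (hl : ∀ a b v, l a (b ⊗ₜ v) = (a * b) ⊗ₜ v)
    (hr : ∀ p a b, r (CrossProduct.basis k φ p) (a ⊗ₜ e b) =
      (a * CrossProduct.basis k φ (p.1 * b, p.2)) ⊗ₜ e (CrossProduct.ractMem hG b p.2))
    (hd : ∀ p, d (CrossProduct.basis k φ p) = ∑ b : C,
      (CrossProduct.basis k φ (p.1 * b, p.2) ⊗ₜ e (CrossProduct.ractMem hG b p.2) -
        CrossProduct.basis k φ p ⊗ₜ e b)) (f : M → k) :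
    restrictionMap φ e (GroupCalculus.d k C⁻¹ f) = d (CrossProduct.ofFun φ f) := by
  rw [CrossProduct.d_eq e hG hl hr hd, CrossProduct.theta, map_sum, map_sum,
    ← Finset.sum_sub_distrib, restrictionMap_apply]
  refine Finset.sum_congr rfl fun b _ => ?_
  rw [rightMul_ofFun e hr, hl, one_mul, mul_one, ← TensorProduct.sub_tmul, ← map_sub]
  rfl

/-- The calculus on k(M) is spanned by the forms f dg, and the map intertwines the left
multiplications and differentials. -/
theorem range_restrictionMap (hC₁ : (1 : M) ∉ C) {hG : ∀ a ∈ C, ∀ u : G, ract φ a u ∈ C}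
    {l r : CrossProduct k φ →ₗ[k] CrossProduct k φ ⊗[k] V →ₗ[k] CrossProduct k φ ⊗[k] V}
    {d : CrossProduct k φ →ₗ[k] CrossProduct k φ ⊗[k] V}
    (hl : ∀ a b v, l a (b ⊗ₜ v) = (a * b) ⊗ₜ v)
    (hr : ∀ p a b, r (CrossProduct.basis k φ p) (a ⊗ₜ e b) =
      (a * CrossProduct.basis k φ (p.1 * b, p.2)) ⊗ₜ e (CrossProduct.ractMem hG b p.2))
    (hd : ∀ p, d (CrossProduct.basis k φ p) = ∑ b : C,
      (CrossProduct.basis k φ (p.1 * b, p.2) ⊗ₜ e (CrossProduct.ractMem hG b p.2) -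
        CrossProduct.basis k φ p ⊗ₜ e b)) :
    LinearMap.range (restrictionMap φ e) = Submodule.span k {ω | ∃ f g : M → k, ω =
      l (CrossProduct.ofFun φ f) (d (CrossProduct.ofFun φ g))} := by
  rw [LinearMap.range_eq_map,
    ← (GroupCalculus.isDifferentialCalculus k C⁻¹ (by simpa using hC₁)).surjective,
    Submodule.map_span]
  congr 1
  ext ω
  simp only [Set.mem_image, Set.mem_ofPred_eq, ← restrictionMap_d e hl hr hd,
    ← restrictionMap_leftMul e hl]
  constructor
  · rintro ⟨_, ⟨f, g, rfl⟩, rfl⟩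
    exact ⟨f, g, rfl⟩
  · rintro ⟨f, g, rfl⟩
    exact ⟨_, ⟨f, g, rfl⟩, rfl⟩

end Restriction

theorem rightMul_ofGroup_canonicalForms {k : Type*} [Field k] {G M : Type*} [Group G] [Group M]
    {φ : G →* MulAut M} {C : Set M} [Fintype G] [Fintype M] (hC : ∃ t : M, C = conjugatesOf t)
    (hC₁ : (1 : M) ∉ C) (hG : ∀ a ∈ C, ∀ u : G, ract φ a u ∈ C) (a : C) (u : G) :
    (canonicalTangentSpace k hC hG).rightMul (pairing k φ) (CrossProduct.ofGroup k φ u)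
      (1 ⊗ₜ canonicalForms k hC hC₁ hG a) =
      CrossProduct.ofGroup k φ u ⊗ₜ canonicalForms k hC hC₁ hG (CrossProduct.ractMem hG a u) := by
  simp only [CrossProduct.ofGroup, map_sum, LinearMap.sum_apply, rightMul_canonicalForms, one_mul]
  rw [← TensorProduct.sum_tmul]
  congr 1
  exact Fintype.sum_equiv (Equiv.mulRight (a : M)) _ _ fun s => rfl

end

theorem mainTheorem8 (k : Type*) [Field k] [CharZero k]
    {G M : Type*} [Group G] [Fintype G] [Group M] [Fintype M] (φ : G →* MulAut M)
    (C : Set M) (hC : ∃ t : M, C = conjugatesOf t) (hC₁ : (1 : M) ∉ C)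
    (hG : ∀ a ∈ C, ∀ u : G, ract φ a u ∈ C) :
    -- the sum `𝓜 = ⨁_{a ∈ C} k f_a` is direct, with non-zero summands
    LinearIndependent k (fun a : C => tangentVector k φ (a : M)) ∧
    -- `𝓜` has the form `⨁_{z ∈ C} 𝓜₀ ◁ z̄`, with `C` a conjugacy class of `X` in the set of degrees,
    -- and `𝓜₀` an irreducible subrepresentation of `J_{z₀}` under the centralizer of `z₀` in `X`
    (inl '' C ⊆ Set.range (xDegree (φ := φ))) ∧
    (∀ z₀ ∈ C, inl '' C = conjugatesOf (inl z₀ : M ⋊[φ] G) ∧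
      ∃ M₀ : Submodule k ((M ⋊[φ] G) →₀ k), M₀ = Submodule.span k {tangentVector k φ z₀} ∧
        M₀ ≤ kxHomogeneous k (inl z₀) ∧
        IsIrreducibleUnder
          (kxAct k '' (Subgroup.centralizer {(inl z₀ : M ⋊[φ] G)} : Set (M ⋊[φ] G))) M₀ ∧
        ∀ zbar : C → M ⋊[φ] G, (∀ z : C, (zbar z)⁻¹ * inl z₀ * zbar z = inl (z : M)) →
          iSupIndep (fun z : C => M₀.map (kxAct k (zbar z))) ∧
          canonicalSubspace k φ C = ⨆ z : C, M₀.map (kxAct k (zbar z))) ∧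
    -- `𝓜` is an irreducible subrepresentation of `kX` under `D(X)`
    IsIrreducibleUnder (doubleOperators k φ) (canonicalSubspace k φ C) ∧
    -- `𝓜` is isomorphic through `Π` to an irreducible quantum tangent space `L`, as `D(H)`-modules
    (∃ L : QuantumTangentSpace k (CrossCoproduct k φ),
      L.toSubmodule = (canonicalSubspace k φ C).map (toHPlus k φ) ∧
      L.IsIrreducible ∧
      Set.InjOn (toHPlus k φ) (canonicalSubspace k φ C) ∧
      (∀ h : CrossCoproduct k φ, ∀ m ∈ canonicalSubspace k φ C, ∃ m' ∈ canonicalSubspace k φ C,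
        toH k φ m' = adAction (k := k) h (toH k φ m) ∧
        toHPlus k φ m' = adAction (k := k) h (toHPlus k φ m)) ∧
      (∀ f : Module.Dual k (CrossCoproduct k φ),
        ∀ m ∈ canonicalSubspace k φ C, ∃ m' ∈ canonicalSubspace k φ C,
          toH k φ m' = coregAction f (toH k φ m) ∧
          toHPlus k φ m' = coregActionPlus f (toHPlus k φ m)) ∧
      -- the calculus defined by `L` on `A = k(M) ⋊ kG` is a bicovariant differential calculus
      IsBicovariantCalculus (A := CrossProduct k φ) L.leftMul (L.rightMul (pairing k φ))
        (L.d (pairing k φ)) ∧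
      -- the basis `e_a` of invariant 1-forms dual to the basis `f_a`
      ∃ e : Module.Basis C k L.InvForms,
        (∀ (a b : C) (l : L.toSubmodule), (l : CrossCoproduct k φ) =
          toHPlus k φ (tangentVector k φ (b : M)) → e a l = if a = b then 1 else 0) ∧
        -- `e_a δ_s = δ_{sa} e_a`
        (∀ (a : C) (s : M),
          L.rightMul (pairing k φ) (CrossProduct.ofFun φ (Pi.single s 1))
              ((1 : CrossProduct k φ) ⊗ₜ[k] e a) =
            CrossProduct.ofFun φ (Pi.single (s * (a : M)) 1) ⊗ₜ[k] e a) ∧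
        -- `e_a u = u e_{u⁻¹au}`
        (∀ (a : C) (u : G),
          L.rightMul (pairing k φ) (CrossProduct.ofGroup k φ u)
              ((1 : CrossProduct k φ) ⊗ₜ[k] e a) =
            CrossProduct.ofGroup k φ u ⊗ₜ[k] e ⟨ract φ a u, hG a a.2 u⟩) ∧
        -- `dδ_s = ∑_a (δ_{sa} - δ_s) e_a`
        (∀ s : M, L.d (pairing k φ) (CrossProduct.ofFun φ (Pi.single s 1)) =
          ∑ a : C, (CrossProduct.ofFun φ (Pi.single (s * (a : M)) 1) -
            CrossProduct.ofFun φ (Pi.single s 1)) ⊗ₜ[k] e a) ∧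
        -- `du = ∑_a u (e_{u⁻¹au} - e_a)`
        (∀ u : G, L.d (pairing k φ) (CrossProduct.ofGroup k φ u) =
          ∑ a : C, CrossProduct.ofGroup k φ u ⊗ₜ[k] (e ⟨ract φ a u, hG a a.2 u⟩ - e a)) ∧
        -- the calculus on `k(M)` defined by `C⁻¹` is the restriction to `k(M)` of this calculus,
        -- `e_{a⁻¹}` being identified with `e_a`
        IsDifferentialCalculus (GroupCalculus.leftMul k C⁻¹) (GroupCalculus.rightMul k C⁻¹)
          (GroupCalculus.d k C⁻¹) ∧
        ∃ j : ((C⁻¹ : Set M) → M → k) →ₗ[k] L.Omega (CrossProduct k φ),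
          Function.Injective j ∧
          (∀ (a : C) (f : M → k),
            j (Pi.single ⟨(a : M)⁻¹, Set.inv_mem_inv.2 a.2⟩ f) =
              CrossProduct.ofFun φ f ⊗ₜ[k] e a) ∧
          (∀ f ω, j (GroupCalculus.leftMul k C⁻¹ f ω) =
            L.leftMul (CrossProduct.ofFun φ f) (j ω)) ∧
          (∀ f ω, j (GroupCalculus.rightMul k C⁻¹ f ω) =
            L.rightMul (pairing k φ) (CrossProduct.ofFun φ f) (j ω)) ∧
          (∀ f, j (GroupCalculus.d k C⁻¹ f) = L.d (pairing k φ) (CrossProduct.ofFun φ f)) ∧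
          LinearMap.range j = Submodule.span k {ω | ∃ f g : M → k, ω =
            L.leftMul (CrossProduct.ofFun φ f) (L.d (pairing k φ) (CrossProduct.ofFun φ g))}) ∧
    -- every non-trivial conjugacy class `K` of `G` is invariant under conjugation, and so defines
    -- a bicovariant differential calculus on the quantum double `D(G)`
    (∀ K : Set G, (∃ t : G, K = conjugatesOf t) → (1 : G) ∉ K →
      (∀ a ∈ K, ∀ u : G, ract MulAut.conj a u ∈ K) ∧
      ∃ L : QuantumTangentSpace k (CrossCoproduct k (MulAut.conj : G →* MulAut G)),
        L.toSubmodule = (canonicalSubspace k MulAut.conj K).map (toHPlus k MulAut.conj) ∧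
        L.IsIrreducible ∧
        IsBicovariantCalculus (A := QuantumDouble k G) L.leftMul
          (L.rightMul (pairing k MulAut.conj)) (L.d (pairing k MulAut.conj))) := by
  refine ⟨linearIndependent_tangentVector hC₁, ?_, fun z₀ hz₀ => ?_,
    isIrreducibleUnder_doubleOperators hC hC₁ hG, ?_, fun K hK hK₁ => ?_⟩
  · rintro _ ⟨a, -, rfl⟩
    exact ⟨_, xDegree_tangent 1 a⟩
  · refine ⟨inl_image_eq_conjugatesOf hC hG hz₀, _, rfl, ?_, ?_, fun zbar hz => ?_⟩
    · rw [Submodule.span_singleton_le_iff_mem]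
      exact tangentVector_mem_kxHomogeneous z₀
    · refine isIrreducibleUnder_span_singleton
        (tangentVector_ne_zero (ne_of_mem_of_not_mem hz₀ hC₁)) ?_
      rintro _ ⟨y, hy, rfl⟩
      refine kxAct_tangentVector ?_
      rw [mul_assoc, inv_mul_eq_iff_eq_mul]
      exact Subgroup.mem_centralizer_iff.1 hy _ rfl
    -- Whatever representative z̄ is chosen, it moves the line 𝓜₀ onto k f_z.
    · have h : ∀ z : C, (Submodule.span k {tangentVector k φ z₀}).map (kxAct k (zbar z)) =
          Submodule.span k {tangentVector k φ (z : M)} := fun z => by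
        rw [Submodule.map_span, Set.image_singleton, kxAct_tangentVector (hz z)]
      simp only [h]
      refine ⟨(linearIndependent_tangentVector hC₁).iSupIndep_span_singleton, ?_⟩
      rw [canonicalSubspace, iSup_subtype']
  · have hl : ∀ (a b : CrossProduct k φ) (v : (canonicalTangentSpace k hC hG).InvForms),
        (canonicalTangentSpace k hC hG).leftMul a (b ⊗ₜ[k] v) = (a * b) ⊗ₜ v := fun _ _ _ => rfl
    have hr := rightMul_canonicalForms (k := k) hC hC₁ hG
    have hd := d_canonicalTangentSpace (k := k) hC hC₁ hG
    refine ⟨canonicalTangentSpace k hC hG, rfl, isIrreducible_canonicalTangentSpace hC hC₁ hG,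
      injOn_toHPlus hC₁, exists_adAction hC, exists_coregAction hG,
      isBicovariantCalculus_canonicalTangentSpace hC hC₁ hG, canonicalForms k hC hC₁ hG,
      fun a b l h => ?_, fun a s => ?_, rightMul_ofGroup_canonicalForms hC hC₁ hG, fun s => ?_,
      fun u => ?_, GroupCalculus.isDifferentialCalculus k C⁻¹ (by simpa using hC₁),
      restrictionMap φ (canonicalForms k hC hC₁ hG), restrictionMap_injective _,
      restrictionMap_single _, restrictionMap_leftMul _ hl, restrictionMap_rightMul _ hr,
      restrictionMap_d _ hl hr hd, range_restrictionMap _ hC₁ hl hr hd⟩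
    · rw [show l = canonicalTangentBasis k hC hC₁ hG b from
        Subtype.ext (h.trans (canonicalTangentBasis_apply hC hC₁ hG b).symm),
        canonicalForms_apply]
      simp only [eq_comm]
    · simp [hr, CrossProduct.ractMem]
    · simp [hd, CrossProduct.ractMem, TensorProduct.sub_tmul]
    -- For u ∈ G the inner form du = θu − uθ is evaluated with e_a u = u e_{a◁u}, without expanding
    -- u over the δ_s.
    · rw [CrossProduct.d_eq _ hG hl hr hd, CrossProduct.theta, map_sum, map_sum,
        ← Finset.sum_sub_distrib]
      refine Finset.sum_congr rfl fun a _ => ?_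
      rw [rightMul_ofGroup_canonicalForms, hl, mul_one, ← TensorProduct.tmul_sub]
      rfl
  · have hKG : ∀ a ∈ K, ∀ u : G, ract MulAut.conj a u ∈ K := fun a ha u => by
      simpa [ract] using conj_mem_of_eq_conjugatesOf hK a ha u⁻¹
    exact ⟨hKG, canonicalTangentSpace k hK hKG, rfl,
      isIrreducible_canonicalTangentSpace hK hK₁ hKG,
      isBicovariantCalculus_canonicalTangentSpace hK hK₁ hKG⟩
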